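/- For a rational number $x$ and an integer $k\ge 0$ let $(x)_k=x(x+1)\cdots(x+k-1)$, with $(x)_0=1$, and for $\ell,m\ge 1$ let $H_m^{(\ell)}=\sum_{k=1}^m 1/k^{\ell}$. For rational numbers $a,b$, a prime $p$ and an integer $e\ge 0$, write $a\equiv b\pmod{p^e}$ if $a-b=p^e u/v$ for some integers $u,v$ with $p\nmid v$. Let $p$ be an odd prime, $s$ a positive integer, and $m=(p^s-1)/2$ or $m=p^s-1$. Then $$\sum_{k=0}^{m}(-1)^k(4k+1)\frac{(1/2)_k^5}{k!^5}\equiv \begin{cases} \dfrac{(1/2)_{(p^s-1)/4}^2}{(1)_{(p^s-1)/4}^2}\left\{p^s+\dfrac{p^{3s}}{4}H_{(p^s-1)/2}^{(2)}-\dfrac{p^{3s}}{8}H_{(p^s-1)/4}^{(2)}\right\}\pmod{p^{s+4}}, & \text{if } p^s\equiv 1\pmod 4,\\[12pt] p^{2s}\,\dfrac{(3/4)_{(p^s-1)/2}}{(5/4)_{(p^s-1)/2}}\pmod{p^{s+4}}, & \text{if } p^s\equiv 3\pmod 4. \end{cases}$$ -/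

import Mathlib

/-- The shifted factorial `(x)_k = x (x + 1) ⋯ (x + k - 1)` of a rational number `x`
(equal to `Γ(x + k) / Γ(x)` whenever `x` is not a pole of `Γ`). -/
noncomputable def shiftedFactorial (x : ℚ) (k : ℕ) : ℚ := (ascPochhammer ℚ k).eval x

/-- The harmonic number of order `l`: `H_m^{(l)} = ∑_{k=1}^m 1 / k^l`. -/
def harmonicOrder (l m : ℕ) : ℚ := ∑ k ∈ Finset.Icc 1 m, 1 / (k : ℚ) ^ l

/-- Congruence `a ≡ b (mod p^e)` of rational numbers: `a - b` is `p^e` times a rational number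
`u / v` whose denominator `v` is not divisible by `p` (so `v ≠ 0` in particular). -/
def RatModEq (p e : ℕ) (a b : ℚ) : Prop :=
  ∃ u v : ℤ, ¬ (p : ℤ) ∣ v ∧ a - b = (p : ℚ) ^ e * ((u : ℚ) / (v : ℚ))

/-- The sum `∑_{k=0}^m (-1)^k (4k + 1) (1/2)_k^5 / k!^5`. -/
noncomputable def ramanujanPartialSum (m : ℕ) : ℚ :=
  ∑ k ∈ Finset.range (m + 1),
    (-1 : ℚ) ^ k * (4 * (k : ℚ) + 1) *
      (shiftedFactorial (1 / 2) k ^ 5 / (k.factorial : ℚ) ^ 5)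

/-! Write h_k = (1/2)_k/k!, n = p^s = 2M + 1, w = n²/4 and P_k(z) = `wellPoised k z`, so that P_k(0)
= h_k². Multiply h_k⁴ = 2 h_k² P_k(w) - P_k(w)² + (h_k² - P_k(w))² by (-1)^k (4k+1) h_k and sum over
k ≤ M. The first two terms are very-well-poised sums with an exact value
(`sum_wellPoised_wellPoised`): (-1)^M n times a Whipple ₃F₂, at z = 0 and z = w, which is a product
whose shape depends on the parity of M. They yield the main terms, after an expansion modulo p⁴ when
M is even.

The last term is p⁴ ∑ (-1)^k (4k+1) h_k⁵ δ_k², because h_k² - P_k(w) = p² h_k² δ_k. The missing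
factor p^s comes from a q-analogue over the localization of ℤ[q] at (p, q - 1): an element vanishing
at the primitive roots of unity of orders p, …, p^s is divisible by the corresponding cyclotomic
polynomials, each equal to p at q = 1 (`atOne_of_atRoot_eq_zero`). The q-sum does vanish there: each
block of length d = 2m' + 1 has zero second half, and r ↦ m' - r changes the sign of the terms in
its first half, for any weight symmetric under this reflection (`sum_blocks_eq_zero`). The squares
δ_k² are such weights.

The terms M < k < n are treated alike: there h_k is divisible by p, which supplies p⁴, and the
vanishing argument supplies p^s. -/

open Finset Polynomial

/-! ### Hypergeometric products and their recurrences -/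

/-- The ratio `(1/2)_k / k!`, as a product. -/
def halfRatio (k : ℕ) : ℚ := ∏ i ∈ range k, (2 * (i : ℚ) + 1) / (2 * i + 2)

/-- The well-poised ratio `∏_{j=1}^{k} ((j - 1/2)² - z) / (j² - z)`. -/
def wellPoised (k : ℕ) (z : ℚ) : ℚ :=
  ∏ i ∈ range k, (((i : ℚ) + 1 / 2) ^ 2 - z) / (((i : ℚ) + 1) ^ 2 - z)

/-- The product `∏_{i=1}^{j} (i² - z)`. -/
def squareProd (j : ℕ) (z : ℚ) : ℚ := ∏ i ∈ range j, (((i : ℚ) + 1) ^ 2 - z)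

/-- The product `(-k)_j (k + 1/2)_j`. -/
def shiftPair (j k : ℕ) : ℚ := ∏ i ∈ range j, ((i : ℚ) - k) * (i + k + 1 / 2)

/-- The product `(-M)_j (M + 1)_j`. -/
def legendrePair (M j : ℕ) : ℚ := ∏ i ∈ range j, ((i : ℚ) - M) * (i + M + 1)

lemma halfRatio_succ (k : ℕ) :
    halfRatio (k + 1) = halfRatio k * ((2 * (k : ℚ) + 1) / (2 * k + 2)) := by
  rw [halfRatio, prod_range_succ, ← halfRatio]

lemma wellPoised_succ (k : ℕ) (z : ℚ) : wellPoised (k + 1) z =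
    wellPoised k z * ((((k : ℚ) + 1 / 2) ^ 2 - z) / (((k : ℚ) + 1) ^ 2 - z)) := by
  rw [wellPoised, prod_range_succ, ← wellPoised]

lemma squareProd_succ (j : ℕ) (z : ℚ) :
    squareProd (j + 1) z = squareProd j z * (((j : ℚ) + 1) ^ 2 - z) := by
  simp [squareProd, prod_range_succ]

lemma shiftPair_succ (j k : ℕ) :
    shiftPair (j + 1) k = shiftPair j k * (((j : ℚ) - k) * (j + k + 1 / 2)) := by
  simp [shiftPair, prod_range_succ]

lemma legendrePair_succ (M j : ℕ) :
    legendrePair M (j + 1) = legendrePair M j * (((j : ℚ) - M) * (j + M + 1)) := by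
  simp [legendrePair, prod_range_succ]

lemma shiftPair_eq_zero {j k : ℕ} (h : k < j) : shiftPair j k = 0 :=
  prod_eq_zero (mem_range.2 h) (by simp)

lemma legendrePair_eq_zero {M j : ℕ} (h : M < j) : legendrePair M j = 0 :=
  prod_eq_zero (mem_range.2 h) (by simp)

lemma squareProd_ne_zero {z : ℚ} (hz : ∀ i : ℕ, ((i : ℚ) + 1) ^ 2 - z ≠ 0) (j : ℕ) :
    squareProd j z ≠ 0 := prod_ne_zero_iff.2 fun i _ => hz i

lemma shiftPair_succ_right (j k : ℕ) : shiftPair (j + 1) (k + 1) * (k + 1 / 2) =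
    -shiftPair j k * ((k + 1) * (j + k + 1 / 2) * (j + k + 3 / 2)) := by
  induction j with
  | zero => simp [shiftPair]; ring
  | succ j ih =>
    rw [shiftPair_succ (j + 1), mul_right_comm, ih, shiftPair_succ j]
    push_cast; ring

lemma legendrePair_add_two (M j : ℕ) : legendrePair (M + 2) (j + 2) =
    legendrePair M j * ((j + M + 1) * (j + M + 2) * (j + M + 3) * (j + M + 4)) := by
  induction j with
  | zero => simp [legendrePair, prod_range_succ]; ring
  | succ j ih =>
    rw [legendrePair_succ (M + 2), ih, legendrePair_succ M]
    push_cast; ring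

/-! ### Exact summation of the very-well-poised sums -/

/-- The Saalschütz expansion of `wellPoised`. -/
lemma wellPoised_eq_sum {z : ℚ} (hz : ∀ i : ℕ, ((i : ℚ) + 1) ^ 2 - z ≠ 0) (k : ℕ) :
    wellPoised k z = ∑ j ∈ range (k + 1), halfRatio j * shiftPair j k / squareProd j z := by
  induction k with
  | zero => simp [wellPoised, halfRatio, shiftPair, squareProd]
  | succ k ih =>
    -- Telescoping certificate in j for the recurrence in k. At J = k + 1 the right side vanishes
    -- since (-k)_{k+1} = 0.
    have key : ∀ J : ℕ, ∑ j ∈ range (J + 1),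
        ((((k : ℚ) + 1) ^ 2 - z) * (halfRatio j * shiftPair j (k + 1) / squareProd j z)
          - (((k : ℚ) + 1 / 2) ^ 2 - z) * (halfRatio j * shiftPair j k / squareProd j z)) =
        halfRatio J * shiftPair J k / squareProd J z *
          ((J + 1 / 2) * (J + k + 1 / 2) * (2 * k + 3 / 2) / (k + 1 / 2)) := by
      have hk : (k : ℚ) + 1 / 2 ≠ 0 := by positivity
      intro J
      induction J with
      | zero =>
        simp [halfRatio, shiftPair, squareProd]
        field_simp
        ring
      | succ J ihJ =>
        rw [sum_range_succ, ihJ]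
        have h1 : shiftPair (J + 1) (k + 1) =
            -shiftPair J k * ((k + 1) * (J + k + 1 / 2) * (J + k + 3 / 2)) / (k + 1 / 2) := by
          rw [eq_div_iff hk, shiftPair_succ_right]
        have h2 := squareProd_ne_zero hz J
        have h3 := hz J
        rw [h1, halfRatio_succ, shiftPair_succ, squareProd_succ]
        push_cast
        generalize squareProd J z = a at *
        generalize halfRatio J = b at *
        generalize shiftPair J k = c at *
        field_simp
        ring
    have h := key (k + 1)
    rw [shiftPair_eq_zero (Nat.lt_succ_self k)] at h
    rw [sum_sub_distrib, ← mul_sum, ← mul_sum, sum_range_succ _ (k + 1),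
      sum_range_succ (fun j => halfRatio j * shiftPair j k / squareProd j z) (k + 1),
      shiftPair_eq_zero (Nat.lt_succ_self k), ← ih] at h
    rw [sum_range_succ, wellPoised_succ, ← mul_div_assoc, div_eq_iff (hz k)]
    linear_combination -h

/-- At this z the differences of squares factor linearly, and half of the factors cancel against
`halfRatio M` read backwards. This evaluates the k = M term that normalizes the next sum. -/
lemma wellPoised_half (M : ℕ) : wellPoised M (((M : ℚ) + 1 / 2) ^ 2) * halfRatio M
    * ((4 * M + 1) * shiftPair M M) = (2 * M + 1) * legendrePair M M := by
  have h1 : wellPoised M (((M : ℚ) + 1 / 2) ^ 2) * halfRatio M =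
      ∏ i ∈ range M, (((i : ℚ) + M + 1) / (i + M + 3 / 2)) := by
    have e1 : wellPoised M (((M : ℚ) + 1 / 2) ^ 2) =
        (∏ i ∈ range M, (((i : ℚ) + M + 1) / (i + M + 3 / 2))) *
          ∏ i ∈ range M, (((M : ℚ) - i) / (M - i - 1 / 2)) := by
      rw [wellPoised, ← prod_mul_distrib]
      refine prod_congr rfl fun i hi => ?_
      have hi' : (i : ℚ) + 1 ≤ M := by exact_mod_cast mem_range.1 hi
      have a1 : (M : ℚ) - i - 1 / 2 ≠ 0 := by intro h; linarith
      have a2 : (i : ℚ) + M + 3 / 2 ≠ 0 := by positivity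
      rw [div_mul_div_comm, div_eq_div_iff _ (mul_ne_zero a2 a1)]
      · ring
      · rw [show ((i : ℚ) + 1) ^ 2 - (M + 1 / 2) ^ 2 = -((i + M + 3 / 2) * (M - i - 1 / 2)) by ring]
        exact neg_ne_zero.2 (mul_ne_zero a2 a1)
    have e2 : halfRatio M = ∏ i ∈ range M, (((M : ℚ) - i - 1 / 2) / (M - i)) := by
      rw [halfRatio, ← prod_range_reflect]
      refine prod_congr rfl fun i hi => ?_
      have hi' : i + 1 ≤ M := mem_range.1 hi
      have hi'' : (i : ℚ) + 1 ≤ M := by exact_mod_cast hi'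
      rw [show M - 1 - i = M - (i + 1) by omega, Nat.cast_sub hi']
      push_cast
      rw [div_eq_div_iff (by intro h; linarith) (by intro h; linarith)]
      ring
    rw [e1, e2, mul_assoc, ← prod_mul_distrib, prod_eq_one (s := range M) (f := fun i : ℕ =>
      (((M : ℚ) - i) / (M - i - 1 / 2)) * (((M : ℚ) - i - 1 / 2) / (M - i))), mul_one]
    intro i hi
    have hi' : (i : ℚ) + 1 ≤ M := by exact_mod_cast mem_range.1 hi
    have a1 : (M : ℚ) - i - 1 / 2 ≠ 0 := by intro h; linarith
    have a2 : (M : ℚ) - i ≠ 0 := by intro h; linarith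
    rw [div_mul_div_comm, mul_comm, div_self (mul_ne_zero a1 a2)]
  have h2 : (∏ i ∈ range M, ((i : ℚ) + M + 1 / 2)) * (4 * M + 1) =
      (2 * M + 1) * ∏ i ∈ range M, ((i : ℚ) + M + 3 / 2) := by
    have := prod_range_succ' (fun i : ℕ => (i : ℚ) + M + 1 / 2) M
    rw [prod_range_succ] at this
    have e : ∏ i ∈ range M, ((i : ℚ) + M + 3 / 2) =
        ∏ i ∈ range M, (((i + 1 : ℕ) : ℚ) + M + 1 / 2) :=
      prod_congr rfl fun i _ => by push_cast; ring
    rw [e]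
    push_cast at this ⊢
    linear_combination 2 * this
  have h3 : (∏ i ∈ range M, ((i : ℚ) + M + 3 / 2)) ≠ 0 :=
    prod_ne_zero_iff.2 fun i _ => by positivity
  rw [h1, shiftPair, legendrePair, prod_mul_distrib, prod_mul_distrib, prod_div_distrib,
    div_mul_eq_mul_div, div_eq_iff h3]
  linear_combination (∏ i ∈ range M, ((i : ℚ) - M)) * (∏ i ∈ range M, ((i : ℚ) + M + 1)) * h2

lemma shiftPair_right (j k : ℕ) : shiftPair j (k + 1) * ((k + 1 - j) * (k + 1 / 2)) =
    shiftPair j k * ((k + 1) * (k + j + 1 / 2)) := by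
  induction j with
  | zero => simp [shiftPair]
  | succ j ih =>
    rw [shiftPair_succ, shiftPair_succ]
    push_cast
    linear_combination ((j : ℚ) - k) * (j + k + 3 / 2) * ih

lemma sq_sub_half_sq_ne_zero (M i : ℕ) : ((i : ℚ) + 1) ^ 2 - ((M : ℚ) + 1 / 2) ^ 2 ≠ 0 := by
  intro h
  have h1 : ((2 * (i : ℚ) + 2) ^ 2) = (2 * M + 1) ^ 2 := by linear_combination 4 * h
  have h2 : (2 * i + 2) ^ 2 = (2 * M + 1) ^ 2 := by exact_mod_cast h1
  have h3 := Nat.pow_left_injective two_ne_zero h2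
  omega

/-- The very-well-poised sum `∑_{k ≤ M} (-1)^k (4k+1) (1/2)_k/k! P_k((M+1/2)²) (-k)_j (k+1/2)_j`
in closed form. -/
lemma sum_wellPoised_shiftPair (M j : ℕ) :
    ∑ k ∈ range (M + 1), (-1 : ℚ) ^ k * (4 * k + 1) * halfRatio k *
      wellPoised k (((M : ℚ) + 1 / 2) ^ 2) * shiftPair j k =
    (-1) ^ M * (2 * M + 1) * legendrePair M j := by
  set w : ℚ := ((M : ℚ) + 1 / 2) ^ 2 with hw
  have hne := sq_sub_half_sq_ne_zero M
  rw [← hw] at hne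
  set I : ℕ → ℚ := fun j => ∑ k ∈ range (M + 1), (-1 : ℚ) ^ k * (4 * k + 1) * halfRatio k *
      wellPoised k w * shiftPair j k with hI
  have hrec : ∀ j, I (j + 1) = I j * (((j : ℚ) - M) * (j + M + 1)) := by
    intro j
    -- Telescoping certificate in k for the recurrence in j. The boundary term at K = M + 1 dies
    -- because P_{M+1}(w) = 0.
    have key : ∀ K : ℕ, ∑ k ∈ range K, ((-1 : ℚ) ^ k * (4 * k + 1) * halfRatio k *
        wellPoised k w * shiftPair (j + 1) k - (-1 : ℚ) ^ k * (4 * k + 1) * halfRatio k *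
        wellPoised k w * shiftPair j k * (((j : ℚ) - M) * (j + M + 1))) =
        2 * ((-1 : ℚ) ^ K * halfRatio K * wellPoised K w * shiftPair j K) *
          ((K - j) * ((K : ℚ) ^ 2 - w)) := by
      intro K
      induction K with
      | zero =>
        rcases Nat.eq_zero_or_pos j with rfl | h
        · simp
        · simp [shiftPair_eq_zero h]
      | succ K ih =>
        have hk : (K : ℚ) + 1 / 2 ≠ 0 := by positivity
        have h1 : shiftPair j (K + 1) * (K + 1 - j) =
            shiftPair j K * ((K + 1) * (K + j + 1 / 2)) / (K + 1 / 2) := by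
          rw [eq_div_iff hk, ← shiftPair_right]; ring
        have h2 : wellPoised (K + 1) w * (((K : ℚ) + 1) ^ 2 - w) =
            wellPoised K w * (((K : ℚ) + 1 / 2) ^ 2 - w) := by
          rw [wellPoised_succ, mul_assoc, div_mul_cancel₀ _ (hne K)]
        have h3 : halfRatio (K + 1) = halfRatio K * (K + 1 / 2) / (K + 1) := by
          have : (K : ℚ) + 1 ≠ 0 := by positivity
          rw [halfRatio_succ]; field_simp
        have e : 2 * ((-1 : ℚ) ^ (K + 1) * halfRatio (K + 1) * wellPoised (K + 1) w *
            shiftPair j (K + 1)) * ((((K + 1 : ℕ) : ℚ) - j) * (((K + 1 : ℕ) : ℚ) ^ 2 - w)) =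
            -2 * (-1) ^ K * halfRatio (K + 1) * (wellPoised (K + 1) w * (((K : ℚ) + 1) ^ 2 - w)) *
            (shiftPair j (K + 1) * (K + 1 - j)) := by
          push_cast; ring
        rw [sum_range_succ, ih, e, h1, h2, h3, shiftPair_succ]
        have : (K : ℚ) + 1 ≠ 0 := by positivity
        rw [show ((j : ℚ) - M) * (j + M + 1) = (j + 1 / 2) ^ 2 - w by rw [hw]; ring]
        generalize wellPoised K w = a
        generalize halfRatio K = b
        generalize shiftPair j K = c
        field_simp
        ring
    have h := key (M + 1)
    rw [sum_sub_distrib, ← sum_mul] at h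
    have h0 : wellPoised (M + 1) w = 0 := by rw [wellPoised_succ]; simp [hw]
    rw [h0] at h
    simp only [hI]
    linear_combination h
  have hprod : ∀ j, I j = I 0 * legendrePair M j := by
    intro j
    induction j with
    | zero => simp [legendrePair]
    | succ j ih => rw [hrec, ih, legendrePair_succ]; ring
  -- The constant is fixed at j = M, where only the term k = M survives; I 0 then follows by
  -- division.
  have hM : I M = (-1) ^ M * (2 * M + 1) * legendrePair M M := by
    simp only [hI]
    rw [sum_range_succ, sum_eq_zero, zero_add]
    · linear_combination (-1 : ℚ) ^ M * wellPoised_half M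
    · intro k hk
      rw [shiftPair_eq_zero (mem_range.1 hk), mul_zero]
  have hne' : legendrePair M M ≠ 0 := by
    refine prod_ne_zero_iff.2 fun i hi => mul_ne_zero ?_ (by positivity)
    have hi' : (i : ℚ) + 1 ≤ M := by exact_mod_cast mem_range.1 hi
    intro h; linarith
  have h0 : I 0 = (-1) ^ M * (2 * M + 1) :=
    mul_right_cancel₀ hne' (by rw [← hM, ← hprod])
  change I j = _
  rw [hprod, h0]

/-! ### Whipple's sum in product form -/

/-- The Whipple sum `₃F₂(1/2, -M, M+1; 1+y, 1-y; 1)` with `z = y²`. -/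
def whippleSum (M : ℕ) (z : ℚ) : ℚ :=
  ∑ j ∈ range (M + 1), halfRatio j * legendrePair M j / squareProd j z

/-- Expand the second factor by Saalschütz, exchange the sums, and evaluate the inner sum over k in
closed form. -/
lemma sum_wellPoised_wellPoised {z : ℚ} (hz : ∀ i : ℕ, ((i : ℚ) + 1) ^ 2 - z ≠ 0) (M : ℕ) :
    ∑ k ∈ range (M + 1), (-1 : ℚ) ^ k * (4 * k + 1) * halfRatio k *
      wellPoised k (((M : ℚ) + 1 / 2) ^ 2) * wellPoised k z =
    (-1) ^ M * (2 * M + 1) * whippleSum M z := by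
  have h1 : ∀ k ∈ range (M + 1), wellPoised k z =
      ∑ j ∈ range (M + 1), halfRatio j * shiftPair j k / squareProd j z := by
    intro k hk
    rw [wellPoised_eq_sum hz]
    refine sum_subset (range_subset_range.2 (mem_range.1 hk)) fun j _ hj => ?_
    rw [shiftPair_eq_zero (by simpa using hj), mul_zero, zero_div]
  rw [sum_congr rfl fun k hk => by rw [h1 k hk, mul_sum], sum_comm, whippleSum, mul_sum]
  refine sum_congr rfl fun j _ => ?_
  have h2 := sum_wellPoised_shiftPair M j
  have e : (-1 : ℚ) ^ M * (2 * M + 1) * (halfRatio j * legendrePair M j / squareProd j z) =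
    ((-1 : ℚ) ^ M * (2 * M + 1) * legendrePair M j) * (halfRatio j / squareProd j z) := by ring
  rw [e, ← h2, sum_mul]
  exact sum_congr rfl fun k _ => by ring

/-- Creative telescoping with step two in M, which is why even and odd M get different products. -/
lemma whippleSum_add_two {z : ℚ} (hz : ∀ i : ℕ, ((i : ℚ) + 1) ^ 2 - z ≠ 0) (M : ℕ) :
    whippleSum (M + 2) z * (((M : ℚ) + 2) ^ 2 - z) = whippleSum M z * (((M : ℚ) + 1) ^ 2 - z) := by
  have hL : ∀ j, legendrePair (M + 2) (j + 2) =
    legendrePair M j * ((j + M + 1) * (j + M + 2) * (j + M + 3) * (j + M + 4)) :=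
    legendrePair_add_two M
  have key : ∀ J : ℕ, ∑ j ∈ range (J + 2),
      ((((M : ℚ) + 2) ^ 2 - z) * (halfRatio j * legendrePair (M + 2) j / squareProd j z) -
        (((M : ℚ) + 1) ^ 2 - z) * (halfRatio j * legendrePair M j / squareProd j z)) =
      -2 * (2 * M + 3) * (halfRatio (J + 1) * legendrePair M J / squareProd (J + 1) z) *
        ((J + 3 / 2) * (J + M + 2) * (J + M + 1)) := by
    intro J
    induction J with
    | zero =>
      have := hz 0
      simp only [Nat.cast_zero, zero_add, one_pow] at this
      simp [sum_range_succ, halfRatio, legendrePair, squareProd]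
      field_simp
      ring
    | succ J ih =>
      have h2 := squareProd_ne_zero hz (J + 1)
      have h3 := hz (J + 1)
      rw [sum_range_succ, ih, hL, legendrePair_succ M (J + 1), legendrePair_succ M J,
        show J + 2 = J + 1 + 1 from rfl, squareProd_succ (J + 1), halfRatio_succ (J + 1)]
      have h4 : (2 * ((J + 1 : ℕ) : ℚ) + 2) ≠ 0 := by positivity
      generalize squareProd (J + 1) z = a at *
      generalize halfRatio (J + 1) = b at *
      generalize legendrePair M J = c at *
      push_cast at *
      field_simp
      ring
  have h := key (M + 1)
  rw [legendrePair_eq_zero (Nat.lt_succ_self M), sum_sub_distrib, ← mul_sum, ← mul_sum,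
    sum_range_succ (fun j => halfRatio j * legendrePair M j / squareProd j z) (M + 1 + 1),
    sum_range_succ (fun j => halfRatio j * legendrePair M j / squareProd j z) (M + 1),
    legendrePair_eq_zero (Nat.lt_succ_self M), legendrePair_eq_zero (by omega : M < M + 1 + 1)] at h
  rw [whippleSum, whippleSum]
  linear_combination h

lemma whippleSum_even {z : ℚ} (hz : ∀ i : ℕ, ((i : ℚ) + 1) ^ 2 - z ≠ 0) (N : ℕ) :
    whippleSum (2 * N) z =
      ∏ i ∈ range N, ((2 * (i : ℚ) + 1) ^ 2 - z) / ((2 * (i : ℚ) + 2) ^ 2 - z) := by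
  induction N with
  | zero => simp [whippleSum, halfRatio, legendrePair, squareProd]
  | succ N ih =>
    have h := whippleSum_add_two hz (2 * N)
    have h1 := hz (2 * N + 1)
    push_cast at h h1
    rw [prod_range_succ, ← ih, ← mul_div_assoc, eq_div_iff (by convert h1 using 1; ring)]
    rw [← h]; rfl

lemma whippleSum_odd {z : ℚ} (hz : ∀ i : ℕ, ((i : ℚ) + 1) ^ 2 - z ≠ 0) (N : ℕ) :
    whippleSum (2 * N + 1) z = -z / (1 - z) *
      ∏ i ∈ range N, ((2 * (i : ℚ) + 2) ^ 2 - z) / ((2 * (i : ℚ) + 3) ^ 2 - z) := by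
  induction N with
  | zero =>
    have := hz 0
    simp only [Nat.cast_zero, zero_add, one_pow] at this
    simp [whippleSum, halfRatio, legendrePair, squareProd, sum_range_succ]
    field_simp
    ring
  | succ N ih =>
    have h := whippleSum_add_two hz (2 * N + 1)
    have h1 := hz (2 * N + 2)
    push_cast at h h1
    rw [prod_range_succ, ← mul_assoc, ← ih, ← mul_div_assoc,
      eq_div_iff (by convert h1 using 1; ring)]
    rw [show 2 * (N + 1) + 1 = 2 * N + 1 + 2 by ring]
    linear_combination h

/-! ### Cancellation at roots of unity -/

section RootsOfUnity

variable {K : Type*} [Field K] {ζ : K} {d m : ℕ}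

lemma pow_add_mul_period (h : ζ ^ d = 1) (a b : ℕ) : ζ ^ (a + d * b) = ζ ^ a := by
  rw [pow_add, pow_mul, h, one_pow, mul_one]

lemma one_sub_pow_ne_zero (hζ : IsPrimitiveRoot ζ d) {k : ℕ} (hk : ¬ d ∣ k) : 1 - ζ ^ k ≠ 0 :=
  fun h => hk ((hζ.pow_eq_one_iff_dvd k).1 (sub_eq_zero.1 h).symm)

/-- At a primitive root of unity of odd order `2m + 1`, a solution of the recurrence of the
`q`-analogue of `(1/2)_k / k!` satisfies a reflection formula. -/
lemma qHalfRatio_reflect (hζ : IsPrimitiveRoot ζ d) (hd : d = 2 * m + 1) {D : ℕ → K}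
    (hD : ∀ r, D (r + 1) * (1 - ζ ^ (2 * r + 2)) = D r * (1 - ζ ^ (2 * r + 1)))
    {r : ℕ} (hr : r ≤ m) :
    D (m - r) * ζ ^ (m * (m + 1)) = (-1) ^ m * ζ ^ r * D r := by
  have hne : ∀ r, r < m → 1 - ζ ^ (2 * r + 2) ≠ 0 := fun r hr =>
    one_sub_pow_ne_zero hζ fun h => by have := Nat.le_of_dvd (by omega) h; omega
  have hd1 := hζ.pow_eq_one
  have hz : ζ ≠ 0 := hζ.ne_zero (by omega)
  set κ : K := ∏ i ∈ range m, (1 - ζ ^ (2 * i + 1)) / (1 - ζ ^ (2 * i + 2)) with hκ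
  have hinv : ∀ a b, a + b = d → (1 - ζ ^ a) * ζ ^ b = -(1 - ζ ^ b) := by
    intro a b hab
    rw [sub_mul, ← pow_add, hab, hd1]; ring
  have h0 : ∀ r, r ≤ m →
      D r = D 0 * ∏ i ∈ range r, (1 - ζ ^ (2 * i + 1)) / (1 - ζ ^ (2 * i + 2)) := by
    intro r
    induction r with
    | zero => simp
    | succ r ih =>
      intro hr
      have h := hD r
      rw [ih (by omega)] at h
      rw [prod_range_succ, ← mul_assoc, ← mul_div_assoc, eq_div_iff (hne r (by omega)), h]
  have hκ2 : κ * ζ ^ (m * (m + 1)) = (-1) ^ m := by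
    have e1 : κ = (∏ i ∈ range m, (1 - ζ ^ (2 * (m - 1 - i) + 1))) /
        ∏ i ∈ range m, (1 - ζ ^ (2 * i + 2)) := by
      rw [hκ, prod_div_distrib, prod_range_reflect (fun i => 1 - ζ ^ (2 * i + 1))]
    have e2 : ζ ^ (m * (m + 1)) = ∏ i ∈ range m, ζ ^ (2 * i + 2) := by
      rw [prod_pow_eq_pow_sum]
      congr 1
      have : ∀ m : ℕ, m * (m + 1) = ∑ i ∈ range m, (2 * i + 2) := by
        intro m
        induction m with
        | zero => simp
        | succ m ih => rw [sum_range_succ, ← ih]; ring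
      exact this m
    rw [e1, e2, div_mul_eq_mul_div, ← prod_mul_distrib,
      div_eq_iff (prod_ne_zero_iff.2 fun i hi => hne i (mem_range.1 hi))]
    rw [← card_range m, ← prod_const, card_range, ← prod_mul_distrib]
    refine prod_congr rfl fun i hi => ?_
    have := mem_range.1 hi
    rw [hinv _ _ (by omega)]; ring
  have h1 : ∀ r, r ≤ m → D (m - r) = κ * ζ ^ r * D r := by
    intro r
    induction r with
    | zero => intro _; simp [h0 m le_rfl, hκ]; ring
    | succ r ih =>
      intro hr
      have h2 := ih (by omega)
      have h3 := hD (m - (r + 1))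
      have h4 := hD r
      rw [show m - (r + 1) + 1 = m - r by omega, h2] at h3
      have i1 := hinv (2 * (m - (r + 1)) + 2) (2 * r + 1) (by omega)
      have i2 := hinv (2 * (m - (r + 1)) + 1) (2 * r + 2) (by omega)
      refine mul_right_cancel₀ (hne r (by omega)) ?_
      have h5 := congrArg (· * ζ ^ (2 * r + 2)) h3
      simp only [mul_assoc] at h5
      rw [i2, show 2 * r + 2 = (2 * r + 1) + 1 by ring, pow_succ ζ (2 * r + 1),
        ← mul_assoc (1 - _) (ζ ^ (2 * r + 1)) ζ, i1, ← pow_succ] at h5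
      rw [show 2 * r + 1 + 1 = 2 * r + 2 by ring] at h5
      rw [mul_assoc _ (D (r + 1)), h4, pow_succ ζ r]
      linear_combination h5
  rw [h1 r hr]
  linear_combination ζ ^ r * D r * hκ2

/-- The numerator factor 1 - ζ^d enters at r = m, and the later denominators have even exponents
strictly between d and 2d, so they never vanish. -/
lemma qHalfRatio_eq_zero (hζ : IsPrimitiveRoot ζ d) (hd : d = 2 * m + 1) {D : ℕ → K}
    (hD : ∀ r, D (r + 1) * (1 - ζ ^ (2 * r + 2)) = D r * (1 - ζ ^ (2 * r + 1)))
    {i : ℕ} (hi : i < m) : D (m + 1 + i) = 0 := by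
  have hd1 := hζ.pow_eq_one
  induction i with
  | zero =>
    have h := hD m
    rw [← hd, hd1, sub_self, mul_zero] at h
    exact (mul_eq_zero.1 h).resolve_right (one_sub_pow_ne_zero hζ fun h => by
      rw [show 2 * m + 2 = d + 1 by omega, Nat.dvd_add_right (dvd_refl d)] at h
      have := Nat.le_of_dvd one_pos h
      omega)
  | succ i ih =>
    have h := hD (m + 1 + i)
    rw [ih (by omega), zero_mul] at h
    exact (mul_eq_zero.1 h).resolve_right (one_sub_pow_ne_zero hζ fun h => by
      rw [show 2 * (m + 1 + i) + 2 = d + (2 * i + 3) by omega,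
        Nat.dvd_add_right (dvd_refl d)] at h
      obtain ⟨c, hc⟩ := h
      have h1 : c < 2 := by
        by_contra h2
        have := Nat.mul_le_mul_left d (not_lt.1 h2)
        omega
      interval_cases c <;> omega)

/-- Indices above m contribute zero, and r ↦ m - r negates the other terms. The exponent r² + r is
what makes the powers of ζ from the reflection of D⁵ balance. -/
lemma sum_block_eq_zero [CharZero K] (hζ : IsPrimitiveRoot ζ d) (hd : d = 2 * m + 1) {D x : ℕ → K}
    (hD : ∀ r, D (r + 1) * (1 - ζ ^ (2 * r + 2)) = D r * (1 - ζ ^ (2 * r + 1)))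
    (hx : ∀ r ≤ m, x (m - r) = x r) :
    ∑ r ∈ range d, (-1) ^ r * ζ ^ (r ^ 2 + r) * (1 - ζ ^ (4 * r + 1)) * D r ^ 5 * x r = 0 := by
  have hd1 := hζ.pow_eq_one
  have hz : ζ ≠ 0 := hζ.ne_zero (by omega)
  have hvan := fun i hi => qHalfRatio_eq_zero hζ hd hD (i := i) hi
  rw [show d = (m + 1) + m by omega, sum_range_add _ (m + 1) m]
  rw [sum_eq_zero (s := range m) fun i hi => by rw [hvan i (mem_range.1 hi)]; simp, add_zero]
  set f : ℕ → K := fun r =>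
    (-1) ^ r * ζ ^ (r ^ 2 + r) * (1 - ζ ^ (4 * r + 1)) * D r ^ 5 * x r with hf
  have hanti : ∀ r, r ≤ m → f (m - r) = -f r := by
    intro r hr
    obtain ⟨t, rfl⟩ := Nat.exists_eq_add_of_le hr
    have hrefl := qHalfRatio_reflect hζ hd hD hr
    have hxr := hx r hr
    rw [Nat.add_sub_cancel_left] at *
    simp only [hf]
    rw [hxr]
    -- This power clears the negative exponents produced by reflecting D⁵ and 1 - ζ^(4t+1).
    have hpos : ζ ^ (5 * ((r + t) * (r + t + 1)) + (4 * r + 1)) ≠ 0 := pow_ne_zero _ hz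
    refine mul_right_cancel₀ hpos ?_
    have e1 : ζ ^ (t ^ 2 + t + 5 * r) =
        ζ ^ (r ^ 2 + r) * ζ ^ (5 * ((r + t) * (r + t + 1)) + (4 * r + 1)) := by
      rw [← pow_add, ← pow_add_mul_period hd1 _ (d + r)]
      congr 1
      rw [hd]; ring
    have e2 : (1 - ζ ^ (4 * t + 1)) * ζ ^ (4 * r + 1) = -(1 - ζ ^ (4 * r + 1)) := by
      rw [sub_mul, ← pow_add, show 4 * t + 1 + (4 * r + 1) = 0 + d * 2 by omega,
        pow_add_mul_period hd1]
      ring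
    have e3 : D t ^ 5 * ζ ^ (5 * ((r + t) * (r + t + 1))) =
        ((-1) ^ (r + t)) ^ 5 * ζ ^ (5 * r) * D r ^ 5 := by
      rw [mul_comm 5 ((r + t) * (r + t + 1)), pow_mul ζ _ 5, ← mul_pow, hrefl]; ring
    have e4 : (-1 : K) ^ t * ((-1) ^ (r + t)) ^ 5 = (-1) ^ r := by
      rw [← pow_mul, ← pow_add, show t + (r + t) * 5 = r + 2 * (3 * t + 2 * r) by ring, pow_add,
        pow_mul]
      simp
    calc _ = (-1) ^ t * ζ ^ (t ^ 2 + t) * ((1 - ζ ^ (4 * t + 1)) * ζ ^ (4 * r + 1)) *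
          (D t ^ 5 * ζ ^ (5 * ((r + t) * (r + t + 1)))) * x r := by rw [pow_add ζ (5 * _)]; ring
      _ = -(((-1) ^ t * ((-1) ^ (r + t)) ^ 5) * ζ ^ (t ^ 2 + t + 5 * r) *
          (1 - ζ ^ (4 * r + 1)) * D r ^ 5 * x r) := by rw [e2, e3, pow_add]; ring
      _ = _ := by rw [e4, e1]; ring
  have hs := sum_range_reflect f (m + 1)
  have h2 : ∑ j ∈ range (m + 1), f (m + 1 - 1 - j) = -∑ j ∈ range (m + 1), f j := by
    rw [← sum_neg_distrib]
    exact sum_congr rfl fun j hj => hanti j (Nat.lt_succ_iff.1 (mem_range.1 hj))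
  rw [h2] at hs
  exact self_eq_neg.1 hs.symm

/-- A very-well-poised sum of length divisible by the odd number `d` vanishes at the primitive
`d`-th roots of unity, for weights symmetric on the first half of each block of length `d`. -/
lemma sum_blocks_eq_zero [CharZero K] (hζ : IsPrimitiveRoot ζ d) (hd : d = 2 * m + 1)
    {C x : ℕ → K} (hC : ∀ k, C (k + 1) * (1 - ζ ^ (2 * k + 2)) = C k * (1 - ζ ^ (2 * k + 1)))
    (L : ℕ) (hx : ∀ l < L, ∀ r ≤ m, x (d * l + (m - r)) = x (d * l + r)) :
    ∑ k ∈ range (d * L),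
      (-1) ^ k * ζ ^ (k ^ 2 + k) * (1 - ζ ^ (4 * k + 1)) * C k ^ 5 * x k = 0 := by
  have hd1 := hζ.pow_eq_one
  induction L with
  | zero => simp
  | succ L ih =>
    rw [mul_add, mul_one, sum_range_add, ih fun l hl => hx l (by omega), zero_add]
    -- The block lemma leaves D 0 free, so it applies to every translate of C; the recurrence
    -- coefficients have period d.
    have hb := sum_block_eq_zero (D := fun r => C (d * L + r)) (x := fun r => x (d * L + r)) hζ hd
      (fun r => by
        have h := hC (d * L + r)
        rw [show 2 * (d * L + r) + 2 = 2 * r + 2 + d * (2 * L) by ring,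
          show 2 * (d * L + r) + 1 = 2 * r + 1 + d * (2 * L) by ring,
          pow_add_mul_period hd1, pow_add_mul_period hd1] at h
        exact h) (hx L (by omega))
    rw [← mul_zero ((-1 : K) ^ (d * L)), ← hb, mul_sum]
    refine sum_congr rfl fun r _ => ?_
    rw [show (d * L + r) ^ 2 + (d * L + r) = r ^ 2 + r + d * (L * (d * L + 2 * r + 1)) by ring,
      show 4 * (d * L + r) + 1 = 4 * r + 1 + d * (4 * L) by ring,
      pow_add_mul_period hd1, pow_add_mul_period hd1, pow_add]
    ring

end RootsOfUnity

/-! ### The localization of ℤ[q] at (p, q - 1) and its specializations -/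

/-- The integer polynomials whose value at `1` is not divisible by `p`. -/
def unitAtOne (p : ℕ) [hp : Fact p.Prime] : Submonoid ℤ[X] where
  carrier := {v | ¬ (p : ℤ) ∣ v.eval 1}
  one_mem' := by simpa using fun h => hp.out.one_lt.ne' (Int.natCast_dvd_natCast.1 (by simpa using h) |> Nat.dvd_one.1)
  mul_mem' := by
    intro a b ha hb h
    rw [eval_mul] at h
    exact ((Nat.prime_iff_prime_int.1 hp.out).dvd_or_dvd h).elim ha hb

/-- The localization of `ℤ[q]` at the prime ideal `(p, q - 1)`. -/
abbrev QRing (p : ℕ) [Fact p.Prime] : Type := Localization (unitAtOne p)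

section QRing

variable {p : ℕ} [hp : Fact p.Prime]

instance : IsDomain (QRing p) :=
  IsLocalization.isDomain_localization (M := unitAtOne p) fun v hv => by
    refine mem_nonZeroDivisors_of_ne_zero ?_
    rintro rfl
    exact hv (by simp)

/-- The image of a polynomial in `QRing p`. -/
noncomputable def ofPoly (p : ℕ) [Fact p.Prime] : ℤ[X] →+* QRing p := algebraMap ℤ[X] (QRing p)

lemma isUnit_ofPoly {v : ℤ[X]} (hv : ¬ (p : ℤ) ∣ v.eval 1) : IsUnit (ofPoly p v) :=
  IsLocalization.map_units (QRing p) (⟨v, hv⟩ : unitAtOne p)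

/-- Specialization of `q` at a point where no element of `unitAtOne p` vanishes. -/
noncomputable def specialize {K : Type*} [Field K] (x : K) (hx : ∀ v ∈ unitAtOne p, aeval x v ≠ 0) :
    QRing p →+* K :=
  IsLocalization.lift (M := unitAtOne p) (g := (aeval x : ℤ[X] →ₐ[ℤ] K).toRingHom)
    fun v => (hx v v.2).isUnit

lemma specialize_ofPoly {K : Type*} [Field K] (x : K) (hx : ∀ v ∈ unitAtOne p, aeval x v ≠ 0)
    (f : ℤ[X]) : specialize x hx (ofPoly p f) = aeval x f :=
  IsLocalization.lift_eq _ f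

lemma aeval_one_eq (v : ℤ[X]) : aeval (1 : ℚ) v = (v.eval 1 : ℤ) := by
  have := eval₂_at_intCast (p := v) (Int.castRingHom ℚ) 1
  simp [aeval_def]

lemma aeval_one_ne_zero : ∀ v ∈ unitAtOne p, aeval (1 : ℚ) v ≠ 0 := by
  intro v hv h
  rw [aeval_one_eq, Int.cast_eq_zero] at h
  exact hv (h ▸ dvd_zero _)

/-- Specialization at `q = 1`. -/
noncomputable def atOne (p : ℕ) [Fact p.Prime] : QRing p →+* ℚ := specialize 1 aeval_one_ne_zero

lemma cyclotomic_dvd_of_aeval_eq_zero {ζ : ℂ} {n : ℕ} (hn : 0 < n) (hζ : IsPrimitiveRoot ζ n)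
    {f : ℤ[X]} (hf : aeval ζ f = 0) : cyclotomic n ℤ ∣ f := by
  rw [cyclotomic_eq_minpoly hζ hn]
  exact minpoly.isIntegrallyClosed_dvd (hζ.isIntegral hn) hf

/-- A polynomial vanishing at ζ is a multiple of the cyclotomic polynomial, whose value at 1 is p.
So denominators survive specialization at ζ. -/
lemma aeval_root_ne_zero {ζ : ℂ} {i : ℕ} (hζ : IsPrimitiveRoot ζ (p ^ (i + 1))) :
    ∀ v ∈ unitAtOne p, aeval ζ v ≠ 0 := by
  intro v hv h
  obtain ⟨g, rfl⟩ := cyclotomic_dvd_of_aeval_eq_zero (pow_pos hp.out.pos _) hζ h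
  exact hv ⟨g.eval 1, by rw [eval_mul, eval_one_cyclotomic_prime_pow]⟩

/-- The root of unity `exp (2πi / p^(i+1))`. -/
noncomputable def primePowRoot (p i : ℕ) : ℂ := Complex.exp (2 * Real.pi * Complex.I / (p ^ (i + 1) : ℕ))

lemma primePowRoot_spec (p : ℕ) [hp : Fact p.Prime] (i : ℕ) :
    IsPrimitiveRoot (primePowRoot p i) (p ^ (i + 1)) :=
  Complex.isPrimitiveRoot_exp _ (pow_pos hp.out.pos _).ne'

/-- Specialization at `q = exp (2πi / p^(i+1))`. -/
noncomputable def atRoot (p : ℕ) [Fact p.Prime] (i : ℕ) : QRing p →+* ℂ :=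
  specialize (primePowRoot p i) (aeval_root_ne_zero (primePowRoot_spec p i))

lemma exists_mul_eq_ofPoly (f : QRing p) :
    ∃ u v : ℤ[X], ¬ (p : ℤ) ∣ v.eval 1 ∧ f * ofPoly p v = ofPoly p u := by
  obtain ⟨u, v, rfl⟩ := IsLocalization.exists_mk'_eq (unitAtOne p) f
  exact ⟨u, v, v.2, IsLocalization.mk'_spec (QRing p) u v⟩

lemma exists_cyclotomic_mul {i : ℕ} {f : QRing p} (hf : atRoot p i f = 0) :
    ∃ g, f = ofPoly p (cyclotomic (p ^ (i + 1)) ℤ) * g := by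
  obtain ⟨u, v, hv, h⟩ := exists_mul_eq_ofPoly f
  have h1 : aeval (primePowRoot p i) u = 0 := by
    have := congrArg (atRoot p i) h
    rw [map_mul, hf, zero_mul] at this
    rw [this]; exact (specialize_ofPoly _ _ u).symm
  obtain ⟨g, rfl⟩ := cyclotomic_dvd_of_aeval_eq_zero (pow_pos hp.out.pos _) (primePowRoot_spec p i) h1
  obtain ⟨w, hw⟩ := (isUnit_ofPoly hv).exists_right_inv
  refine ⟨ofPoly p g * w, ?_⟩
  rw [← mul_assoc, ← map_mul, ← h, mul_assoc, hw, mul_one]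

/-- An element vanishing at the primitive roots of unity of orders `p, p², …, p^s` has value
divisible by `p^s` at `q = 1`. -/
lemma atOne_of_atRoot_eq_zero {s : ℕ} {f : QRing p} (hf : ∀ i < s, atRoot p i f = 0) :
    ∃ g, atOne p f = (p : ℚ) ^ s * atOne p g := by
  obtain ⟨u, v, hv, h⟩ := exists_mul_eq_ofPoly f
  have h1 : (∏ i ∈ range s, cyclotomic (p ^ (i + 1)) ℤ) ∣ u := by
    refine Finset.prod_dvd_of_isRelPrime ?_ fun i hi => ?_
    · intro i _ j _ hij
      refine (cyclotomic.irreducible (pow_pos hp.out.pos _)).isRelPrime_iff_not_dvd.2 fun hd => hij ?_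
      have h2 := (cyclotomic.irreducible (pow_pos hp.out.pos _)).associated_of_dvd
        (cyclotomic.irreducible (pow_pos hp.out.pos _)) hd
      have h3 := eq_of_monic_of_associated (cyclotomic.monic _ ℤ) (cyclotomic.monic _ ℤ) h2
      have h4 := cyclotomic_injective (R := ℤ) h3
      have := Nat.pow_right_injective hp.out.two_le h4
      omega
    · refine cyclotomic_dvd_of_aeval_eq_zero (pow_pos hp.out.pos _) (primePowRoot_spec p i) ?_
      have := congrArg (atRoot p i) h
      rw [map_mul, hf i (mem_range.1 hi), zero_mul] at this
      rw [this]; exact (specialize_ofPoly _ _ u).symm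
  obtain ⟨g, rfl⟩ := h1
  obtain ⟨w, hw⟩ := (isUnit_ofPoly hv).exists_right_inv
  refine ⟨ofPoly p g * w, ?_⟩
  have h2 : f = ofPoly p (∏ i ∈ range s, cyclotomic (p ^ (i + 1)) ℤ) * (ofPoly p g * w) := by
    rw [← mul_assoc, ← map_mul, ← h, mul_assoc, hw, mul_one]
  conv_lhs => rw [h2]
  rw [map_mul]
  congr 1
  refine (specialize_ofPoly _ _ _).trans ?_
  rw [aeval_one_eq, eval_prod]
  simp [eval_one_cyclotomic_prime_pow]

/-- Values of `atOne` have denominators prime to p, so congruences can be carried as equations with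
a witness in `QRing p`. -/
lemma ratModEq_of_atOne {e : ℕ} {a b : ℚ} {f : QRing p} (h : a - b = (p : ℚ) ^ e * atOne p f) :
    RatModEq p e a b := by
  obtain ⟨u, v, hv, hf⟩ := exists_mul_eq_ofPoly f
  refine ⟨u.eval 1, v.eval 1, hv, ?_⟩
  have h1 := congrArg (atOne p) hf
  rw [map_mul] at h1
  have h2 : atOne p (ofPoly p v) = (v.eval 1 : ℤ) := (specialize_ofPoly _ _ _).trans (aeval_one_eq v)
  have h3 : atOne p (ofPoly p u) = (u.eval 1 : ℤ) := (specialize_ofPoly _ _ _).trans (aeval_one_eq u)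
  have h4 : ((v.eval 1 : ℤ) : ℚ) ≠ 0 := Int.cast_ne_zero.2 fun h0 => hv (h0 ▸ dvd_zero _)
  rw [h, ← h3, ← h1, h2, mul_div_cancel_right₀ _ h4]

/-- The variable `q`. -/
noncomputable def qVar (p : ℕ) [Fact p.Prime] : QRing p := ofPoly p X

/-- The `q`-integer `1 + q + ⋯ + q^(m-1)`. -/
noncomputable def qNat (p : ℕ) [Fact p.Prime] (m : ℕ) : QRing p := ∑ i ∈ range m, qVar p ^ i

lemma atOne_qVar : atOne p (qVar p) = 1 := (specialize_ofPoly _ _ _).trans (by simp)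

lemma atRoot_qVar (i : ℕ) : atRoot p i (qVar p) = primePowRoot p i :=
  (specialize_ofPoly _ _ _).trans (by simp)

lemma atOne_qNat (m : ℕ) : atOne p (qNat p m) = m := by simp [qNat, atOne_qVar]

lemma qNat_ne_zero {m : ℕ} (hm : m ≠ 0) : qNat p m ≠ 0 := fun h => hm <| by
  have := congrArg (atOne p) h
  rw [atOne_qNat, map_zero] at this
  exact_mod_cast this

lemma atRoot_qNat (i m : ℕ) : atRoot p i (qNat p m) * (1 - primePowRoot p i) =
    1 - primePowRoot p i ^ m := by
  simp only [qNat, map_sum, map_pow, atRoot_qVar]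
  exact geom_sum_mul_neg _ _

lemma qNat_mul (a b : ℕ) :
    qNat p (a * b) = qNat p a * ∑ i ∈ range b, (qVar p ^ a) ^ i := by
  induction b with
  | zero => simp [qNat]
  | succ b ih =>
    rw [mul_add, mul_one, qNat, sum_range_add, ← qNat, ih, sum_range_succ, mul_add, ← pow_mul,
      qNat, sum_mul (range a) (fun i => qVar p ^ i) (qVar p ^ _)]
    congr 1
    exact sum_congr rfl fun i _ => by rw [pow_add, mul_comm]

lemma isUnit_geomSum (a : ℕ) {b : ℕ} (hb : ¬ p ∣ b) :
    IsUnit (∑ i ∈ range b, (qVar p ^ a) ^ i) := by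
  have : (∑ i ∈ range b, (qVar p ^ a) ^ i) = ofPoly p (∑ i ∈ range b, (X ^ a) ^ i) := by
    simp [qVar]
  rw [this]
  refine isUnit_ofPoly ?_
  simpa [eval_finsetSum, Int.natCast_dvd_natCast] using hb

/-- For m = p^e b with p ∤ b, [m] is [p^e] times a unit (its value at q = 1 is b), and e ≤ t. -/
lemma qNat_dvd_qNat {m t : ℕ} (hm : m ≠ 0) (ht : ¬ p ^ (t + 1) ∣ m) :
    qNat p m ∣ qNat p (p ^ t) := by
  obtain ⟨e, b, hb, rfl⟩ := Nat.exists_eq_pow_mul_and_not_dvd hm p hp.out.ne_one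
  have he : e ≤ t := by
    by_contra h
    exact ht (Dvd.dvd.mul_right (pow_dvd_pow p (by omega)) b)
  rw [qNat_mul, (isUnit_geomSum (p ^ e) hb).mul_right_dvd]
  exact ⟨_, by rw [← qNat_mul, ← pow_add, Nat.add_sub_cancel' he]⟩

end QRing

/-! ### The q-analogue of (1/2)_k/k! and the divisibility criterion -/

section QRing

variable {p : ℕ} [hp : Fact p.Prime]

/-- The Gaussian binomial coefficient in `QRing p`. -/
noncomputable def qBinom (p : ℕ) [Fact p.Prime] : ℕ → ℕ → QRing p
  | _, 0 => 1
  | 0, _ + 1 => 0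
  | n + 1, k + 1 => qBinom p n k + qVar p ^ (k + 1) * qBinom p n (k + 1)

/-- The `q`-factorial in `QRing p`. -/
noncomputable def qFactorial (p : ℕ) [Fact p.Prime] (n : ℕ) : QRing p :=
  ∏ i ∈ range n, qNat p (i + 1)

lemma qFactorial_succ (n : ℕ) : qFactorial p (n + 1) = qFactorial p n * qNat p (n + 1) :=
  prod_range_succ _ n

lemma qNat_add (a b : ℕ) : qNat p (a + b) = qNat p a + qVar p ^ a * qNat p b := by
  simp only [qNat, sum_range_add, mul_sum, pow_add]

lemma qBinom_eq_zero {n k : ℕ} (h : n < k) : qBinom p n k = 0 := by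
  induction n generalizing k with
  | zero => obtain ⟨k, rfl⟩ := Nat.exists_eq_succ_of_ne_zero h.ne'; simp [qBinom]
  | succ n ih =>
    obtain ⟨k, rfl⟩ := Nat.exists_eq_succ_of_ne_zero (by omega : k ≠ 0)
    simp [qBinom, ih (by omega : n < k), ih (by omega : n < k + 1)]

lemma qBinom_mul (N : ℕ) : ∀ n k, n + k = N →
    qBinom p (n + k) k * qFactorial p k * qFactorial p n = qFactorial p (n + k) := by
  induction N with
  | zero =>
    intro n k h
    obtain ⟨rfl, rfl⟩ : n = 0 ∧ k = 0 := by omega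
    simp [qBinom, qFactorial]
  | succ N ih =>
    intro n k h
    rcases k with _ | k
    · simp [qBinom, qFactorial]
    rcases n with _ | n
    · have := ih 0 k (by omega)
      rw [zero_add] at this ⊢
      rw [qBinom, qBinom_eq_zero (Nat.lt_succ_self k), qFactorial_succ]
      linear_combination qNat p (k + 1) * this
    · have h1 := ih (n + 1) k (by omega)
      have h2 := ih n (k + 1) (by omega)
      rw [show n + 1 + k = n + k + 1 by ring] at h1
      rw [show n + (k + 1) = n + k + 1 by ring] at h2
      rw [show n + 1 + (k + 1) = n + k + 1 + 1 by ring, qBinom, qFactorial_succ (n + k + 1),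
        show n + k + 1 + 1 = (k + 1) + (n + 1) by ring, qNat_add]
      rw [qFactorial_succ n] at *
      rw [qFactorial_succ k] at *
      linear_combination qNat p (k + 1) * h1 + qVar p ^ (k + 1) * qNat p (n + 1) * h2

/-- The `q`-analogue `(q; q²)_k / (q²; q²)_k` of `(1/2)_k / k!` lies in `QRing p` for odd `p`. -/
lemma exists_qHalfRatio (hp2 : p ≠ 2) : ∃ C : ℕ → QRing p, C 0 = 1 ∧
    ∀ k, C (k + 1) * qNat p (2 * k + 2) = C k * qNat p (2 * k + 1) := by
  -- The witness is the Gaussian binomial of (2k, k) over ∏ (1 + q^i)², the q-form of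
  -- binom(2k,k)/4^k; 1 + q^i is a unit since it equals 2 at q = 1.
  have hu : ∀ j, IsUnit (∑ i ∈ range 2, (qVar p ^ j) ^ i) := fun j =>
    isUnit_geomSum j fun h => hp2 ((Nat.prime_dvd_prime_iff_eq hp.out Nat.prime_two).1 h)
  choose u hu using fun j => (hu j).exists_right_inv
  set U : ℕ → QRing p := fun k => ∏ i ∈ range k, u (i + 1) with hU
  set E : ℕ → QRing p := fun k => ∏ i ∈ range k, qNat p (2 * i + 2) with hE
  have hEne : ∀ k, E k ≠ 0 := fun k => prod_ne_zero_iff.2 fun i _ => qNat_ne_zero (by omega)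
  have h1 : ∀ k, E k * U k = qFactorial p k := by
    intro k
    rw [hE, hU, qFactorial, ← prod_mul_distrib]
    refine prod_congr rfl fun i _ => ?_
    rw [show 2 * i + 2 = (i + 1) * 2 by ring, qNat_mul, mul_assoc, hu, mul_one]
  have h2 : ∀ k, qFactorial p (2 * k) = E k * ∏ i ∈ range k, qNat p (2 * i + 1) := by
    intro k
    induction k with
    | zero => simp [qFactorial, hE]
    | succ k ih =>
      rw [show 2 * (k + 1) = 2 * k + 1 + 1 by ring, qFactorial_succ, qFactorial_succ, ih,
        prod_range_succ]
      simp only [hE]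
      rw [prod_range_succ]
      ring
  have h3 : ∀ k, (qBinom p (2 * k) k * U k ^ 2) * E k = ∏ i ∈ range k, qNat p (2 * i + 1) := by
    intro k
    refine mul_left_cancel₀ (hEne k) ?_
    rw [← h2, two_mul, ← qBinom_mul _ k k rfl, ← h1]
    ring
  refine ⟨fun k => qBinom p (2 * k) k * U k ^ 2, by simp [qBinom, hU], fun k => ?_⟩
  refine mul_right_cancel₀ (hEne k) ?_
  have h4 := h3 (k + 1)
  rw [prod_range_succ, ← h3 k] at h4
  simp only [hE, prod_range_succ] at h4 ⊢
  linear_combination h4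

lemma atOne_qHalfRatio {C : ℕ → QRing p} (h0 : C 0 = 1)
    (hC : ∀ k, C (k + 1) * qNat p (2 * k + 2) = C k * qNat p (2 * k + 1)) (k : ℕ) :
    atOne p (C k) = halfRatio k := by
  induction k with
  | zero => simp [h0, halfRatio]
  | succ k ih =>
    have h := congrArg (atOne p) (hC k)
    rw [map_mul, map_mul, atOne_qNat, atOne_qNat, ih] at h
    push_cast at h
    rw [halfRatio_succ, ← mul_div_assoc, eq_div_iff (by positivity), h]

lemma atRoot_qHalfRatio {C : ℕ → QRing p}
    (hC : ∀ k, C (k + 1) * qNat p (2 * k + 2) = C k * qNat p (2 * k + 1)) (i k : ℕ) :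
    atRoot p i (C (k + 1)) * (1 - primePowRoot p i ^ (2 * k + 2)) =
      atRoot p i (C k) * (1 - primePowRoot p i ^ (2 * k + 1)) := by
  have h := congrArg (atRoot p i) (hC k)
  rw [map_mul, map_mul] at h
  rw [← atRoot_qNat, ← atRoot_qNat, ← mul_assoc, ← mul_assoc, h]

lemma primePowRoot_ne_one (i : ℕ) : 1 - primePowRoot p i ≠ 0 := by
  have h := one_sub_pow_ne_zero (primePowRoot_spec p i) (k := 1) fun h =>
    (Nat.one_lt_pow (by omega) hp.out.one_lt).ne' (Nat.dvd_one.1 h)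
  rwa [pow_one] at h

lemma atOne_cyclotomic (t : ℕ) : atOne p (ofPoly p (cyclotomic (p ^ (t + 1)) ℤ)) = p := by
  refine (specialize_ofPoly _ _ _).trans ?_
  rw [aeval_one_eq, eval_one_cyclotomic_prime_pow]; simp

lemma atRoot_cyclotomic_self (t : ℕ) :
    atRoot p t (ofPoly p (cyclotomic (p ^ (t + 1)) ℤ)) = 0 := by
  refine (specialize_ofPoly _ _ _).trans ?_
  rw [cyclotomic_eq_minpoly (primePowRoot_spec p t) (pow_pos hp.out.pos _), minpoly.aeval]

lemma primePowRoot_pow_eq_one {i t : ℕ} (h : i < t) : primePowRoot p i ^ p ^ t = 1 :=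
  ((primePowRoot_spec p i).pow_eq_one_iff_dvd _).2 (pow_dvd_pow p h)

lemma atRoot_cyclotomic_of_lt {i t : ℕ} (h : i < t) :
    atRoot p i (ofPoly p (cyclotomic (p ^ (t + 1)) ℤ)) = p := by
  refine (specialize_ofPoly _ _ _).trans ?_
  rw [cyclotomic_prime_pow_eq_geom_sum hp.out]
  simp [primePowRoot_pow_eq_one h]

lemma isUnit_one_sub_cyclotomic_mul (t : ℕ) (b : QRing p) :
    IsUnit (1 - ofPoly p (cyclotomic (p ^ (t + 1)) ℤ) ^ 2 * b) := by
  obtain ⟨u, v, hv, h⟩ := exists_mul_eq_ofPoly b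
  refine isUnit_of_mul_isUnit_left (y := ofPoly p v) ?_
  have : (1 - ofPoly p (cyclotomic (p ^ (t + 1)) ℤ) ^ 2 * b) * ofPoly p v =
      ofPoly p (v - cyclotomic (p ^ (t + 1)) ℤ ^ 2 * u) := by
    rw [map_sub, map_mul, map_pow, ← h]; ring
  rw [this]
  refine isUnit_ofPoly fun hd => hv ?_
  rw [eval_sub, eval_mul, eval_pow, eval_one_cyclotomic_prime_pow] at hd
  have h2 : (p : ℤ) ∣ (p : ℤ) ^ 2 * u.eval 1 := Dvd.dvd.mul_right (dvd_pow_self _ two_ne_zero) _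
  simpa using dvd_add hd h2

/-- If the values of `T k` at the roots of unity of orders `p, …, p^s` are those of `C k ^ 5`, up
to weights symmetric on the first half of each block, then the corresponding very-well-poised sum
at `q = 1` is divisible by `p^s`. -/
lemma atOne_sum_of_weights (hp2 : p ≠ 2) {C : ℕ → QRing p}
    (hC : ∀ k, C (k + 1) * qNat p (2 * k + 2) = C k * qNat p (2 * k + 1)) (s : ℕ) (T : ℕ → QRing p)
    (x : ℕ → ℕ → ℂ)
    (hT : ∀ i < s, ∀ k < p ^ s, atRoot p i (T k) = atRoot p i (C k) ^ 5 * x i k)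
    (hx : ∀ i < s, ∀ l < p ^ (s - (i + 1)), ∀ r ≤ (p ^ (i + 1) - 1) / 2,
      x i (p ^ (i + 1) * l + ((p ^ (i + 1) - 1) / 2 - r)) = x i (p ^ (i + 1) * l + r)) :
    ∃ g, ∑ k ∈ range (p ^ s), (-1 : ℚ) ^ k * (4 * k + 1) * atOne p (T k) =
      (p : ℚ) ^ s * atOne p g := by
  set f : QRing p := ∑ k ∈ range (p ^ s), (-1) ^ k * qVar p ^ (k ^ 2 + k) * qNat p (4 * k + 1) * T k
    with hf
  have h1 : ∑ k ∈ range (p ^ s), (-1 : ℚ) ^ k * (4 * k + 1) * atOne p (T k) = atOne p f := by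
    simp [hf, atOne_qVar, atOne_qNat]
  rw [h1]
  refine atOne_of_atRoot_eq_zero fun i hi => ?_
  have hodd : p ^ (i + 1) = 2 * ((p ^ (i + 1) - 1) / 2) + 1 := by
    obtain ⟨c, hc⟩ := (hp.out.odd_of_ne_two hp2).pow (n := i + 1)
    omega
  have h2 := sum_blocks_eq_zero (primePowRoot_spec p i) hodd (C := fun k => atRoot p i (C k))
    (x := x i) (atRoot_qHalfRatio hC i) (p ^ (s - (i + 1))) (hx i hi)
  rw [← pow_add, Nat.add_sub_cancel' hi] at h2
  refine (mul_eq_zero.1 (Eq.trans ?_ h2)).resolve_right (primePowRoot_ne_one (p := p) i)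
  rw [hf, map_sum, sum_mul]
  refine sum_congr rfl fun k hk => ?_
  simp only [map_mul, map_pow, map_neg, map_one, atRoot_qVar]
  rw [hT i hi k (mem_range.1 hk), ← atRoot_qNat]
  ring

end QRing

/-! ### Divisibility of the interpolation error and of the tail -/

section QRing

variable {p : ℕ} [hp : Fact p.Prime]

/-- A m is a q-analogue of p^t/m; it serves to write n/m as p times an element of the localization.
-/
lemma exists_qQuotient (p : ℕ) [hp : Fact p.Prime] (t : ℕ) : ∃ A : ℕ → QRing p,
    ∀ m, ¬ p ^ (t + 1) ∣ m → qNat p m * A m = qNat p (p ^ t) := by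
  have h : ∀ m, ∃ a, ¬ p ^ (t + 1) ∣ m → qNat p m * a = qNat p (p ^ t) := by
    intro m
    by_cases hm : p ^ (t + 1) ∣ m
    · exact ⟨0, fun h => absurd hm h⟩
    · obtain ⟨a, ha⟩ := qNat_dvd_qNat (by rintro rfl; exact hm (dvd_zero _)) hm
      exact ⟨a, fun _ => ha.symm⟩
  choose A hA using h
  exact ⟨A, hA⟩

lemma atOne_qQuotient {t : ℕ} {A : ℕ → QRing p}
    (hA : ∀ m, ¬ p ^ (t + 1) ∣ m → qNat p m * A m = qNat p (p ^ t)) {m : ℕ}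
    (hm : ¬ p ^ (t + 1) ∣ m) : (m : ℚ) * atOne p (A m) = (p : ℚ) ^ t := by
  have h := congrArg (atOne p) (hA m hm)
  rw [map_mul, atOne_qNat, atOne_qNat] at h
  exact_mod_cast h

lemma atRoot_qQuotient {t : ℕ} {A : ℕ → QRing p}
    (hA : ∀ m, ¬ p ^ (t + 1) ∣ m → qNat p m * A m = qNat p (p ^ t)) (i : ℕ) {m : ℕ}
    (hm : ¬ p ^ (t + 1) ∣ m) :
    (1 - primePowRoot p i ^ m) * atRoot p i (A m) = 1 - primePowRoot p i ^ p ^ t := by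
  have h := congrArg (atRoot p i) (hA m hm)
  rw [map_mul] at h
  rw [← atRoot_qNat, ← atRoot_qNat, ← h]
  ring

lemma two_mul_half_add_one (hp2 : p ≠ 2) (i : ℕ) : 2 * ((p ^ i - 1) / 2) + 1 = p ^ i := by
  obtain ⟨c, hc⟩ := (hp.out.odd_of_ne_two hp2).pow (n := i)
  omega

/-- The relative deviation of `wellPoised k (p^(2s)/4)` from `halfRatio k ^ 2` is `p²` times the
value at `1` of elements of `QRing p` that are symmetric at the relevant roots of unity. -/
lemma exists_deviation (hp2 : p ≠ 2) (t : ℕ) : ∃ δ : ℕ → QRing p,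
    (∀ k ≤ (p ^ (t + 1) - 1) / 2,
      wellPoised k ((((p ^ (t + 1) - 1) / 2 : ℕ) + 1 / 2 : ℚ) ^ 2) =
        halfRatio k ^ 2 * (1 - (p : ℚ) ^ 2 * atOne p (δ k))) ∧
    (∀ i < t, ∀ l, ∀ r ≤ (p ^ (i + 1) - 1) / 2,
      atRoot p i (δ (p ^ (i + 1) * l + r)) = atRoot p i (δ (p ^ (i + 1) * l))) ∧
    (∀ r ≤ (p ^ (t + 1) - 1) / 2,
      atRoot p t (δ ((p ^ (t + 1) - 1) / 2 - r)) = atRoot p t (δ r)) := by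
  obtain ⟨A, hA⟩ := exists_qQuotient p t
  set Φ := ofPoly p (cyclotomic (p ^ (t + 1)) ℤ) with hΦ
  -- At q = 1, Φ² w(m) becomes n²/m². The factor q^m makes w invariant under m ↦ n - m at roots of
  -- order n, as x/(1-x)² is under x ↦ 1/x.
  set w : ℕ → QRing p := fun m => qVar p ^ m * A m ^ 2 with hw
  choose e he using fun b => (isUnit_one_sub_cyclotomic_mul (p := p) t b).exists_right_inv
  -- Solves 1 - Φ² δ(k+1) = (1 - Φ² δ(k)) (1 - Φ² w(2k+1)) / (1 - Φ² w(2k+2)).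
  set δ : ℕ → QRing p := fun k => Nat.rec 0 (fun k d =>
    (d + w (2 * k + 1) - w (2 * k + 2) - Φ ^ 2 * d * w (2 * k + 1)) * e (w (2 * k + 2))) k with hδ
  have hrec : ∀ k, δ (k + 1) * (1 - Φ ^ 2 * w (2 * k + 2)) =
      δ k + w (2 * k + 1) - w (2 * k + 2) - Φ ^ 2 * δ k * w (2 * k + 1) := by
    intro k
    change (δ k + w (2 * k + 1) - w (2 * k + 2) - Φ ^ 2 * δ k * w (2 * k + 1)) *
      e (w (2 * k + 2)) * _ = _
    rw [mul_assoc, mul_comm (e _), he, mul_one]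
  have hδ0 : δ 0 = 0 := rfl
  set M := (p ^ (t + 1) - 1) / 2 with hM
  have hn : 2 * M + 1 = p ^ (t + 1) := two_mul_half_add_one hp2 (t + 1)
  have hndvd : ∀ m, 0 < m → m < p ^ (t + 1) → ¬ p ^ (t + 1) ∣ m := fun m h1 h2 h3 =>
    absurd (Nat.le_of_dvd h1 h3) (by omega)
  refine ⟨δ, ?_, ?_, ?_⟩
  · intro k
    induction k with
    | zero => intro _; simp [wellPoised, halfRatio, hδ0]
    | succ k ih =>
      intro hk
      have h1 := congrArg (atOne p) (hrec k)
      simp only [map_mul, map_sub, map_add, map_pow, map_one, hΦ, atOne_cyclotomic, hw,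
        atOne_qVar, one_pow, one_mul] at h1
      have ha := atOne_qQuotient hA (hndvd (2 * k + 1) (by omega) (by omega))
      have hb := atOne_qQuotient hA (hndvd (2 * k + 2) (by omega) (by omega))
      have hne := sq_sub_half_sq_ne_zero M k
      have hnQ : (2 * M + 1 : ℚ) = (p : ℚ) ^ t * p := by rw [← pow_succ]; exact_mod_cast hn
      rw [wellPoised_succ, ih (by omega), halfRatio_succ, ← mul_div_assoc, div_eq_iff hne]
      push_cast at ha hb
      generalize atOne p (A (2 * k + 1)) = a at *
      generalize atOne p (A (2 * k + 2)) = b at *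
      generalize atOne p (δ k) = y at *
      generalize atOne p (δ (k + 1)) = y' at *
      have e1 : ((k : ℚ) + 1 / 2) ^ 2 - (M + 1 / 2) ^ 2 =
          (2 * k + 1) ^ 2 * (1 - p ^ 2 * a ^ 2) / 4 := by
        have : ((M : ℚ) + 1 / 2) ^ 2 = (p ^ t * p) ^ 2 / 4 := by rw [← hnQ]; ring
        rw [this, ← ha]; ring
      have e2 : ((k : ℚ) + 1) ^ 2 - (M + 1 / 2) ^ 2 =
          (2 * k + 2) ^ 2 * (1 - p ^ 2 * b ^ 2) / 4 := by
        have : ((M : ℚ) + 1 / 2) ^ 2 = (p ^ t * p) ^ 2 / 4 := by rw [← hnQ]; ring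
        rw [this, ← hb]; ring
      have e3 : (1 - (p : ℚ) ^ 2 * y') * (1 - p ^ 2 * b ^ 2) =
          (1 - p ^ 2 * y) * (1 - p ^ 2 * a ^ 2) := by linear_combination -(p : ℚ) ^ 2 * h1
      have hk2 : (2 * (k : ℚ) + 2) ≠ 0 := by positivity
      rw [e1, e2, mul_pow, div_pow]
      field_simp
      linear_combination -halfRatio k ^ 2 * e3
  -- At roots of lower order [p^t] vanishes, hence so does w away from multiples of p^(i+1); δ is
  -- constant on the first half of a block.
  · intro i hi l r
    have hN : 2 * ((p ^ (i + 1) - 1) / 2) + 1 = p ^ (i + 1) := two_mul_half_add_one hp2 (i + 1)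
    have hw0 : ∀ m, ¬ p ^ (i + 1) ∣ m → atRoot p i (w m) = 0 := by
      intro m hm
      have h1 := atRoot_qQuotient hA i
        (fun h : p ^ (t + 1) ∣ m => hm ((pow_dvd_pow p (by omega)).trans h))
      rw [primePowRoot_pow_eq_one hi, sub_self] at h1
      have h2 := (mul_eq_zero.1 h1).resolve_left (one_sub_pow_ne_zero (primePowRoot_spec p i) hm)
      simp [hw, h2]
    induction r with
    | zero => intro _; rfl
    | succ r ih =>
      intro hr
      have h1 := congrArg (atRoot p i) (hrec (p ^ (i + 1) * l + r))
      have z : ∀ c, 0 < c → c < p ^ (i + 1) →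
          atRoot p i (w (p ^ (i + 1) * (2 * l) + c)) = 0 := by
        intro c hc hc'
        refine hw0 _ fun h => ?_
        rw [Nat.dvd_add_right (dvd_mul_right _ _)] at h
        exact absurd (Nat.le_of_dvd hc h) (by omega)
      have z1 := z (2 * r + 1) (by omega) (by omega)
      have z2 := z (2 * r + 2) (by omega) (by omega)
      rw [show p ^ (i + 1) * (2 * l) + (2 * r + 1) = 2 * (p ^ (i + 1) * l + r) + 1 by ring] at z1
      rw [show p ^ (i + 1) * (2 * l) + (2 * r + 2) = 2 * (p ^ (i + 1) * l + r) + 2 by ring] at z2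
      simp only [map_mul, map_sub, map_add, z1, z2, mul_zero, sub_zero, add_zero, map_one,
        mul_one] at h1
      rw [← ih (by omega), ← h1]; rfl
  -- At order p^(t+1), Φ = 0 makes the recursion additive. The symmetry of w gives δ(M-r) = δ(M) +
  -- δ(r), and r = M forces δ(M) = 0.
  · have hstep : ∀ k, atRoot p t (δ (k + 1)) =
        atRoot p t (δ k) + atRoot p t (w (2 * k + 1)) - atRoot p t (w (2 * k + 2)) := by
      intro k
      have h1 := congrArg (atRoot p t) (hrec k)
      simpa [hΦ, atRoot_cyclotomic_self] using h1
    have hsymm : ∀ a b, 0 < a → 0 < b → a + b = p ^ (t + 1) →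
        atRoot p t (w a) = atRoot p t (w b) := by
      intro a b ha hb hab
      have h1 := atRoot_qQuotient hA t (hndvd a ha (by omega))
      have h2 := atRoot_qQuotient hA t (hndvd b hb (by omega))
      have h3 : primePowRoot p t ^ a * primePowRoot p t ^ b = 1 := by
        rw [← pow_add, hab, (primePowRoot_spec p t).pow_eq_one]
      have na := one_sub_pow_ne_zero (primePowRoot_spec p t) (hndvd a ha (by omega))
      have nb := one_sub_pow_ne_zero (primePowRoot_spec p t) (hndvd b hb (by omega))
      simp only [hw, map_mul, map_pow, atRoot_qVar]
      rw [← h2] at h1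
      generalize primePowRoot p t ^ a = x at *
      generalize primePowRoot p t ^ b = y at *
      generalize atRoot p t (A a) = u at *
      generalize atRoot p t (A b) = v at *
      refine mul_left_cancel₀ (pow_ne_zero 2 na) ?_
      calc (1 - x) ^ 2 * (x * u ^ 2) = x * ((1 - x) * u) ^ 2 := by ring
        _ = x * ((1 - y) * v) ^ 2 := by rw [h1]
        _ = (1 - x) ^ 2 * (y * v ^ 2) := by
          linear_combination (v ^ 2 * (y - x)) * h3
    have hrefl : ∀ r ≤ M, atRoot p t (δ (M - r)) = atRoot p t (δ M) + atRoot p t (δ r) := by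
      intro r
      induction r with
      | zero => intro _; simp [hδ0]
      | succ r ih =>
        intro hr
        have h1 := hstep (M - (r + 1))
        rw [show M - (r + 1) + 1 = M - r by omega, ih (by omega),
          hsymm (2 * (M - (r + 1)) + 1) (2 * r + 2) (by omega) (by omega) (by omega),
          hsymm (2 * (M - (r + 1)) + 2) (2 * r + 1) (by omega) (by omega) (by omega)] at h1
        rw [hstep r]
        linear_combination -h1
    have hM0 : atRoot p t (δ M) = 0 := by
      have h := hrefl M le_rfl
      rw [Nat.sub_self, hδ0, map_zero] at h
      exact self_eq_neg.1 (eq_neg_of_add_eq_zero_left h.symm)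
    intro r hr
    rw [hrefl r hr, hM0, zero_add]

/-- With b = (p^(t+1) - 1)/2, a = (p^(i+1) - 1)/2 and c = (p^(t-i) - 1)/2 one has b = p^(i+1) c + a.
The cutoff k ≤ b thus keeps or drops the first half of each block as a whole, so its indicator is a
symmetric weight. -/
lemma half_split (hp2 : p ≠ 2) {i t : ℕ} (hi : i ≤ t) {l r r' : ℕ}
    (hr' : r' ≤ (p ^ (i + 1) - 1) / 2)
    (h : p ^ (i + 1) * l + r ≤ (p ^ (t + 1) - 1) / 2) :
    p ^ (i + 1) * l + r' ≤ (p ^ (t + 1) - 1) / 2 := by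
  have h1 := two_mul_half_add_one hp2 (i + 1)
  have h2 := two_mul_half_add_one hp2 (t + 1)
  have h3 := two_mul_half_add_one hp2 (t - i)
  have h4 : p ^ (t + 1) = p ^ (i + 1) * p ^ (t - i) := by
    rw [← pow_add]; congr 1; omega
  set a := (p ^ (i + 1) - 1) / 2
  set b := (p ^ (t + 1) - 1) / 2
  set c := (p ^ (t - i) - 1) / 2
  have h5 : b = p ^ (i + 1) * c + a := by
    rw [← h3] at h4
    have : p ^ (i + 1) * (2 * c + 1) = 2 * (p ^ (i + 1) * c) + p ^ (i + 1) := by ring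
    omega
  have h6 : l ≤ c := by
    by_contra hl
    have := Nat.mul_le_mul_left (p ^ (i + 1)) (show c + 1 ≤ l by omega)
    rw [mul_add, mul_one] at this
    omega
  have := Nat.mul_le_mul_left (p ^ (i + 1)) h6
  omega

lemma half_split_iff (hp2 : p ≠ 2) {i t : ℕ} (hi : i ≤ t) {l r : ℕ}
    (hr : r ≤ (p ^ (i + 1) - 1) / 2) :
    p ^ (i + 1) * l + ((p ^ (i + 1) - 1) / 2 - r) ≤ (p ^ (t + 1) - 1) / 2 ↔
      p ^ (i + 1) * l + r ≤ (p ^ (t + 1) - 1) / 2 :=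
  ⟨half_split hp2 hi hr, half_split hp2 hi (Nat.sub_le _ _)⟩

/-- The terms with `(p^s - 1)/2 < k < p^s` contribute a multiple of `p^(s+4)`. -/
lemma tail_divisible (hp2 : p ≠ 2) (t : ℕ) : ∃ g, ∑ k ∈ range (p ^ (t + 1)),
      (-1 : ℚ) ^ k * (4 * k + 1) * (if k ≤ (p ^ (t + 1) - 1) / 2 then 0 else halfRatio k ^ 5) =
    (p : ℚ) ^ (t + 1 + 4) * atOne p g := by
  obtain ⟨C, hC0, hC⟩ := exists_qHalfRatio hp2
  set M := (p ^ (t + 1) - 1) / 2 with hM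
  have hn : 2 * M + 1 = p ^ (t + 1) := two_mul_half_add_one hp2 (t + 1)
  have hz : ∀ k, M < k → k < p ^ (t + 1) → atRoot p t (C k) = 0 := by
    intro k h1 h2
    obtain ⟨i, rfl⟩ := Nat.exists_eq_add_of_le (show M + 1 ≤ k from h1)
    exact qHalfRatio_eq_zero (primePowRoot_spec p t) hn.symm
      (D := fun k => atRoot p t (C k)) (atRoot_qHalfRatio hC t) (by omega)
  have hex : ∀ k, ∃ c, M < k → k < p ^ (t + 1) →
      C k = ofPoly p (cyclotomic (p ^ (t + 1)) ℤ) * c := by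
    intro k
    by_cases h : M < k ∧ k < p ^ (t + 1)
    · obtain ⟨c, hc⟩ := exists_cyclotomic_mul (hz k h.1 h.2)
      exact ⟨c, fun _ _ => hc⟩
    · exact ⟨0, fun h1 h2 => absurd ⟨h1, h2⟩ h⟩
  choose c hc using hex
  obtain ⟨g, hg⟩ := atOne_sum_of_weights hp2 hC (t + 1)
    (fun k => if k ≤ M then 0 else C k * c k ^ 4)
    -- At lower orders Φ takes the value p, so c = C/p and C c⁴ = C⁵/p⁴; at the top order C already
    -- vanishes.
    (fun _ k => if k ≤ M then 0 else ((p : ℂ) ^ 4)⁻¹) (by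
      intro i hi k hk
      by_cases h : k ≤ M
      · simp [h]
      · simp only [h, if_false]
        rw [map_mul, map_pow]
        rcases Nat.lt_succ_iff_lt_or_eq.1 hi with hi | rfl
        · have h1 := congrArg (atRoot p i) (hc k (not_le.1 h) hk)
          rw [map_mul, atRoot_cyclotomic_of_lt hi] at h1
          have h2 : (p : ℂ) ≠ 0 := Nat.cast_ne_zero.2 hp.out.ne_zero
          rw [h1]
          field_simp
        · rw [hz k (not_le.1 h) hk]; ring) (by
      intro i hi l _ r hr
      simp only [half_split_iff hp2 (Nat.lt_succ_iff.1 hi) hr, hM])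
  refine ⟨g, ?_⟩
  rw [pow_add (p : ℚ) (t + 1) 4, mul_right_comm, ← hg, sum_mul]
  refine sum_congr rfl fun k hk => ?_
  by_cases h : k ≤ M
  · simp [h]
  · simp only [h, if_false]
    have h1 := congrArg (atOne p) (hc k (not_le.1 h) (mem_range.1 hk))
    rw [map_mul, atOne_cyclotomic, atOne_qHalfRatio hC0 hC] at h1
    rw [map_mul, map_pow, atOne_qHalfRatio hC0 hC, h1]
    ring

/-- The quadratic error term of the interpolation is divisible by `p^(s+4)`. -/
lemma deviation_divisible (hp2 : p ≠ 2) (t : ℕ) :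
    ∃ g, ∑ k ∈ range ((p ^ (t + 1) - 1) / 2 + 1), (-1 : ℚ) ^ k * (4 * k + 1) * (halfRatio k *
      (halfRatio k ^ 2 - wellPoised k ((((p ^ (t + 1) - 1) / 2 : ℕ) + 1 / 2 : ℚ) ^ 2)) ^ 2) =
    (p : ℚ) ^ (t + 1 + 4) * atOne p g := by
  obtain ⟨C, hC0, hC⟩ := exists_qHalfRatio hp2
  obtain ⟨δ, h1, h2, h3⟩ := exists_deviation hp2 t
  set M := (p ^ (t + 1) - 1) / 2 with hM
  have hn : 2 * M + 1 = p ^ (t + 1) := two_mul_half_add_one hp2 (t + 1)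
  obtain ⟨g, hg⟩ := atOne_sum_of_weights hp2 hC (t + 1)
    (fun k => if k ≤ M then C k ^ 5 * δ k ^ 2 else 0)
    (fun i k => if k ≤ M then atRoot p i (δ k) ^ 2 else 0) (by
      intro i _ k _
      by_cases h : k ≤ M <;> simp [h]) (by
      intro i hi l hl r hr
      simp only [half_split_iff hp2 (Nat.lt_succ_iff.1 hi) hr, hM]
      rcases Nat.lt_succ_iff_lt_or_eq.1 hi with hi | rfl
      · rw [h2 i hi l _ hr, h2 i hi l _ (Nat.sub_le _ _)]
      · obtain rfl : l = 0 := by simpa using hl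
        simp only [mul_zero, zero_add]
        rw [h3 r hr])
  refine ⟨g, ?_⟩
  rw [pow_add (p : ℚ) (t + 1) 4, mul_right_comm, ← hg, sum_mul, ← hn, show 2 * M + 1 = (M + 1) + M by ring,
    sum_range_add _ (M + 1) M]
  rw [sum_eq_zero (s := range M) fun k _ => by simp [show ¬ (M + 1 + k ≤ M) by omega], add_zero]
  refine sum_congr rfl fun k hk => ?_
  have hk' : k ≤ M := Nat.lt_succ_iff.1 (mem_range.1 hk)
  rw [if_pos hk', h1 k hk', map_mul, map_pow, map_pow, atOne_qHalfRatio hC0 hC]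
  ring

end QRing

/-! ### The interpolation identity and its main terms -/

lemma shiftedFactorial_eq_prod (x : ℚ) (k : ℕ) :
    shiftedFactorial x k = ∏ i ∈ range k, (x + i) := by
  induction k with
  | zero => simp [shiftedFactorial]
  | succ k ih =>
    rw [prod_range_succ, ← ih, shiftedFactorial, ascPochhammer_succ_eval, shiftedFactorial]

lemma shiftedFactorial_half_div (k : ℕ) :
    shiftedFactorial (1 / 2) k / shiftedFactorial 1 k = halfRatio k := by
  rw [shiftedFactorial_eq_prod, shiftedFactorial_eq_prod, ← prod_div_distrib]
  refine prod_congr rfl fun i _ => ?_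
  rw [div_eq_div_iff (by positivity) (by positivity)]
  ring

lemma shiftedFactorial_one (k : ℕ) : shiftedFactorial 1 k = k.factorial := by
  rw [shiftedFactorial_eq_prod, ← prod_range_add_one_eq_factorial]
  push_cast
  exact prod_congr rfl fun i _ => add_comm _ _

lemma ramanujanPartialSum_eq (m : ℕ) : ramanujanPartialSum m =
    ∑ k ∈ range (m + 1), (-1 : ℚ) ^ k * (4 * k + 1) * halfRatio k ^ 5 := by
  refine sum_congr rfl fun k _ => ?_
  rw [← div_pow, ← shiftedFactorial_one, shiftedFactorial_half_div]

lemma wellPoised_zero (k : ℕ) : wellPoised k 0 = halfRatio k ^ 2 := by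
  rw [wellPoised, halfRatio, ← prod_pow]
  refine prod_congr rfl fun i _ => ?_
  rw [sub_zero, sub_zero, ← div_pow]
  congr 1
  rw [div_eq_div_iff (by positivity) (by positivity)]
  ring

lemma ramanujanPartialSum_eq_whippleSum (M : ℕ) : ramanujanPartialSum M =
    (-1) ^ M * (2 * M + 1) * (2 * whippleSum M 0 - whippleSum M (((M : ℚ) + 1 / 2) ^ 2)) +
      ∑ k ∈ range (M + 1), (-1 : ℚ) ^ k * (4 * k + 1) * (halfRatio k *
        (halfRatio k ^ 2 - wellPoised k (((M : ℚ) + 1 / 2) ^ 2)) ^ 2) := by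
  have h1 := sum_wellPoised_wellPoised (z := 0) (fun i => by rw [sub_zero]; positivity) M
  have h2 := sum_wellPoised_wellPoised (sq_sub_half_sq_ne_zero M) M
  rw [mul_sub, ← h2, ← mul_assoc, mul_comm _ (2 : ℚ), mul_assoc 2, ← h1,
    ramanujanPartialSum_eq, mul_sum, ← sum_sub_distrib, ← sum_add_distrib]
  refine sum_congr rfl fun k _ => ?_
  rw [wellPoised_zero]
  ring

lemma whippleSum_even_zero (N : ℕ) : whippleSum (2 * N) 0 = halfRatio N ^ 2 := by
  rw [whippleSum_even (fun i => by rw [sub_zero]; positivity), halfRatio, ← prod_pow]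
  exact prod_congr rfl fun i _ => by rw [sub_zero, sub_zero, div_pow]

lemma whippleSum_odd_zero (N : ℕ) : whippleSum (2 * N + 1) 0 = 0 := by
  rw [whippleSum_odd (fun i => by rw [sub_zero]; positivity)]; simp

lemma whippleSum_odd_half (N : ℕ) :
    whippleSum (2 * N + 1) ((((2 * N + 1 : ℕ) : ℚ) + 1 / 2) ^ 2) = (4 * N + 3) *
      (shiftedFactorial (3 / 4) (2 * N + 1) / shiftedFactorial (5 / 4) (2 * N + 1)) := by
  rw [whippleSum_odd (sq_sub_half_sq_ne_zero _), shiftedFactorial_eq_prod,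
    shiftedFactorial_eq_prod, ← prod_div_distrib]
  set ρ : ℕ → ℚ := fun j => (3 / 4 + j) / (5 / 4 + j) with hρ
  have h1 : ∏ i ∈ range N, ((2 * (i : ℚ) + 2) ^ 2 - (((2 * N + 1 : ℕ) : ℚ) + 1 / 2) ^ 2) /
      ((2 * (i : ℚ) + 3) ^ 2 - (((2 * N + 1 : ℕ) : ℚ) + 1 / 2) ^ 2) =
      (∏ i ∈ range N, (3 / 4 + ((N - 1 - i : ℕ) : ℚ)) / (1 / 4 + ((N - 1 - i : ℕ) : ℚ))) *
        ∏ i ∈ range N, ρ (N + 1 + i) := by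
    rw [← prod_mul_distrib]
    refine prod_congr rfl fun i hi => ?_
    have hi' : i + 1 ≤ N := mem_range.1 hi
    have hne : (2 * (i : ℚ) + 3) ^ 2 - (((2 * N + 1 : ℕ) : ℚ) + 1 / 2) ^ 2 ≠ 0 := by
      have := sq_sub_half_sq_ne_zero (2 * N + 1) (2 * i + 2)
      convert this using 2
      push_cast; ring
    rw [div_mul_div_comm, div_eq_div_iff hne (by positivity),
      show N - 1 - i = N - (i + 1) by omega, Nat.cast_sub hi']
    push_cast
    ring
  -- Shifting the denominators from 1/4 to 5/4 telescopes, leaving 4n + 1.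
  have h2 : ∀ n : ℕ, ∏ i ∈ range n, (3 / 4 + (i : ℚ)) / (1 / 4 + i) =
      (4 * n + 1) * ∏ i ∈ range n, ρ i := by
    intro n
    induction n with
    | zero => simp
    | succ n ih =>
      rw [prod_range_succ, prod_range_succ, ih]
      simp only [hρ]
      have h3 : (1 / 4 + (n : ℚ)) ≠ 0 := by positivity
      have h4 : (5 / 4 + (n : ℚ)) ≠ 0 := by positivity
      generalize ∏ i ∈ range n, (3 / 4 + (i : ℚ)) / (5 / 4 + i) = x
      push_cast
      field_simp
      ring
  rw [h1, prod_range_reflect (fun i : ℕ => (3 / 4 + (i : ℚ)) / (1 / 4 + i)), h2,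
    show 2 * N + 1 = N + 1 + N by ring, prod_range_add, prod_range_succ]
  change _ = _ * (_ * ρ N * ∏ i ∈ range N, ρ (N + 1 + i))
  have h5 : ρ N = (4 * N + 3) / (4 * N + 5) := by
    simp only [hρ]
    rw [div_eq_div_iff (by positivity) (by positivity)]
    ring
  rw [h5]
  have h6 : (1 : ℚ) - (((N + 1 + N : ℕ) : ℚ) + 1 / 2) ^ 2 =
      -((4 * N + 1) * (4 * N + 5) / 4) := by push_cast; ring
  have h7 : (4 * (N : ℚ) + 1) ≠ 0 := by positivity
  have h8 : (4 * (N : ℚ) + 5) ≠ 0 := by positivity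
  rw [h6]
  generalize ∏ i ∈ range N, ρ (N + 1 + i) = x
  change _ = _ * ((∏ i ∈ range N, ρ i) * _ * _)
  generalize ∏ i ∈ range N, ρ i = y
  push_cast
  field_simp
  ring

/-! ### Expansion modulo p⁴ and conclusion -/

section Prime

variable {p : ℕ} [hp : Fact p.Prime]

/-- First-order expansion in p². The remainder stays p-integral because Φ, with value p at q = 1,
makes 1 - Φ² b invertible in the localization. -/
lemma exists_prod_expansion (t : ℕ) (a b : ℕ → QRing p) (j : ℕ) : ∃ g : QRing p,
    ∏ i ∈ range j, (1 - (p : ℚ) ^ 2 * atOne p (a i)) / (1 - (p : ℚ) ^ 2 * atOne p (b i)) =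
      1 - (p : ℚ) ^ 2 * ∑ i ∈ range j, (atOne p (a i) - atOne p (b i)) +
        (p : ℚ) ^ 4 * atOne p g := by
  induction j with
  | zero => exact ⟨0, by simp⟩
  | succ j ih =>
    obtain ⟨g, hg⟩ := ih
    obtain ⟨e, he⟩ := (isUnit_one_sub_cyclotomic_mul (p := p) t (b j)).exists_right_inv
    have he' := congrArg (atOne p) he
    simp only [map_mul, map_sub, map_pow, map_one, atOne_cyclotomic] at he'
    set S := ∑ i ∈ range j, (a i - b i) with hS
    have hS' : ∑ i ∈ range j, (atOne p (a i) - atOne p (b i)) = atOne p S := by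
      simp [hS]
    refine ⟨(S * a j + g * (1 - ofPoly p (cyclotomic (p ^ (t + 1)) ℤ) ^ 2 * a j) - S * b j -
      a j * b j + b j ^ 2) * e, ?_⟩
    rw [prod_range_succ, hg, sum_range_succ, hS']
    simp only [map_mul, map_sub, map_add, map_pow, map_one, atOne_cyclotomic]
    rw [← mul_div_assoc, div_eq_iff (left_ne_zero_of_mul_eq_one he')]
    linear_combination -((p : ℚ) ^ 4 * (atOne p S * atOne p (a j) +
      atOne p g * (1 - (p : ℚ) ^ 2 * atOne p (a j)) - atOne p S * atOne p (b j) -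
      atOne p (a j) * atOne p (b j) + atOne p (b j) ^ 2)) * he'

lemma harmonicOrder_eq (l m : ℕ) :
    harmonicOrder l m = ∑ i ∈ range m, 1 / ((i : ℚ) + 1) ^ l := by
  rw [harmonicOrder, ← Finset.Ico_add_one_right_eq_Icc, sum_Ico_eq_sum_range]
  refine sum_congr (by simp) fun i _ => ?_
  push_cast; rw [add_comm]

/-- The even-index part of the order-2 sum up to 2N is a quarter of the sum up to N; subtracting an
eighth therefore flips its sign. -/
lemma harmonicOrder_two_mul (N : ℕ) : harmonicOrder 2 (2 * N) / 4 - harmonicOrder 2 N / 8 =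
    ∑ i ∈ range N, ((1 / (4 * (i : ℚ) + 2)) ^ 2 - (1 / (4 * (i : ℚ) + 4)) ^ 2) := by
  rw [harmonicOrder_eq, harmonicOrder_eq]
  induction N with
  | zero => simp
  | succ N ih =>
    rw [sum_range_succ (fun i : ℕ => (1 / (4 * (i : ℚ) + 2)) ^ 2 - (1 / (4 * (i : ℚ) + 4)) ^ 2) N,
      ← ih, show 2 * (N + 1) = 2 * N + 1 + 1 by ring, sum_range_succ _ (2 * N + 1),
      sum_range_succ _ (2 * N), sum_range_succ _ N]
    have h1 : (N : ℚ) + 1 ≠ 0 := by positivity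
    have h2 : 2 * (N : ℚ) + 1 ≠ 0 := by positivity
    have e1 : 1 / (4 * (N : ℚ) + 4) = 1 / (N + 1) / 4 := by field_simp
    have e2 : 1 / (4 * (N : ℚ) + 2) = 1 / (2 * N + 1) / 2 := by field_simp; ring
    have e3 : 1 / (((2 * N + 1 : ℕ) : ℚ) + 1) ^ 2 = (1 / (N + 1)) ^ 2 / 4 := by
      push_cast
      rw [show 2 * (N : ℚ) + 1 + 1 = 2 * (N + 1) by ring]; field_simp; norm_num
    rw [e1, e2, e3]
    push_cast
    simp only [← one_div_pow]
    ring

lemma whippleSum_even_half {t N : ℕ} (hN : p ^ (t + 1) = 4 * N + 1) : ∃ g : QRing p,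
    whippleSum (2 * N) ((((2 * N : ℕ) : ℚ) + 1 / 2) ^ 2) = halfRatio N ^ 2 *
      (1 - ((p : ℚ) ^ (t + 1)) ^ 2 * (harmonicOrder 2 (2 * N) / 4 - harmonicOrder 2 N / 8) +
        (p : ℚ) ^ 4 * atOne p g) := by
  obtain ⟨A, hA⟩ := exists_qQuotient p t
  obtain ⟨g, hg⟩ := exists_prod_expansion (p := p) t (fun i => A (4 * i + 2) ^ 2)
    (fun i => A (4 * i + 4) ^ 2) N
  have hnQ : (4 * N + 1 : ℚ) = (p : ℚ) ^ t * p := by rw [← pow_succ]; exact_mod_cast hN.symm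
  have hdvd : ∀ m, 0 < m → m < p ^ (t + 1) → ¬ p ^ (t + 1) ∣ m := fun m h1 h2 h3 =>
    absurd (Nat.le_of_dvd h1 h3) (by omega)
  have ha : ∀ i < N, atOne p (A (4 * i + 2)) = (p : ℚ) ^ t / (4 * i + 2) := by
    intro i hi
    have := atOne_qQuotient hA (hdvd (4 * i + 2) (by omega) (by omega))
    push_cast at this
    rw [eq_div_iff (by positivity), ← this]; ring
  have hb : ∀ i < N, atOne p (A (4 * i + 4)) = (p : ℚ) ^ t / (4 * i + 4) := by
    intro i hi
    have := atOne_qQuotient hA (hdvd (4 * i + 4) (by omega) (by omega))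
    push_cast at this
    rw [eq_div_iff (by positivity), ← this]; ring
  refine ⟨g, ?_⟩
  have h1 : (p : ℚ) ^ 2 * ∑ i ∈ range N, (atOne p (A (4 * i + 2) ^ 2) - atOne p (A (4 * i + 4) ^ 2))
      = ((p : ℚ) ^ (t + 1)) ^ 2 * (harmonicOrder 2 (2 * N) / 4 - harmonicOrder 2 N / 8) := by
    rw [harmonicOrder_two_mul, mul_sum, mul_sum]
    refine sum_congr rfl fun i hi => ?_
    rw [map_pow, map_pow, ha i (mem_range.1 hi), hb i (mem_range.1 hi)]
    ring
  rw [← h1, ← hg, whippleSum_even (sq_sub_half_sq_ne_zero _), halfRatio, ← prod_pow,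
    ← prod_mul_distrib]
  refine prod_congr rfl fun i hi => ?_
  rw [map_pow, map_pow, ha i (mem_range.1 hi), hb i (mem_range.1 hi)]
  have e1 : (2 * (i : ℚ) + 1) ^ 2 - (((2 * N : ℕ) : ℚ) + 1 / 2) ^ 2 =
      (2 * i + 1) ^ 2 * (1 - (p : ℚ) ^ 2 * ((p : ℚ) ^ t / (4 * i + 2)) ^ 2) := by
    have : (((2 * N : ℕ) : ℚ) + 1 / 2) ^ 2 = ((p : ℚ) ^ t * p) ^ 2 / 4 := by
      rw [← hnQ]; push_cast; ring
    rw [this, show 4 * (i : ℚ) + 2 = 2 * (2 * i + 1) by ring]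
    have : 2 * (i : ℚ) + 1 ≠ 0 := by positivity
    field_simp
    ring
  have e2 : (2 * (i : ℚ) + 2) ^ 2 - (((2 * N : ℕ) : ℚ) + 1 / 2) ^ 2 =
      (2 * i + 2) ^ 2 * (1 - (p : ℚ) ^ 2 * ((p : ℚ) ^ t / (4 * i + 4)) ^ 2) := by
    have : (((2 * N : ℕ) : ℚ) + 1 / 2) ^ 2 = ((p : ℚ) ^ t * p) ^ 2 / 4 := by
      rw [← hnQ]; push_cast; ring
    rw [this, show 4 * (i : ℚ) + 4 = 2 * (2 * i + 2) by ring]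
    have : 2 * (i : ℚ) + 2 ≠ 0 := by positivity
    field_simp
    ring
  rw [e1, e2, mul_div_mul_comm, ← div_pow]

lemma ramanujanPartialSum_sub_half (hp2 : p ≠ 2) {t m : ℕ}
    (hm : m = (p ^ (t + 1) - 1) / 2 ∨ m = p ^ (t + 1) - 1) : ∃ g : QRing p,
    ramanujanPartialSum m - ramanujanPartialSum ((p ^ (t + 1) - 1) / 2) =
      (p : ℚ) ^ (t + 1 + 4) * atOne p g := by
  rcases hm with rfl | rfl
  · exact ⟨0, by simp⟩
  · obtain ⟨g, hg⟩ := tail_divisible hp2 t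
    refine ⟨g, ?_⟩
    have hn := two_mul_half_add_one hp2 (t + 1)
    set M := (p ^ (t + 1) - 1) / 2
    rw [← hg, ramanujanPartialSum_eq, ramanujanPartialSum_eq, ← hn,
      show 2 * M + 1 - 1 + 1 = M + 1 + M by omega, show 2 * M + 1 = M + 1 + M by ring,
      sum_range_add _ (M + 1), sum_range_add _ (M + 1),
      sum_eq_zero (s := range (M + 1))
        (f := fun k : ℕ => (-1 : ℚ) ^ k * (4 * k + 1) * if k ≤ M then 0 else halfRatio k ^ 5)
        fun k hk => by rw [if_pos (Nat.lt_succ_iff.1 (mem_range.1 hk)), mul_zero], zero_add, add_sub_cancel_left]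
    refine sum_congr rfl fun k _ => ?_
    rw [if_neg (by omega)]

end Prime

theorem corollary1p4 (p s m : ℕ) (hp : p.Prime) (hp2 : p ≠ 2) (hs : 1 ≤ s)
    (hm : m = (p ^ s - 1) / 2 ∨ m = p ^ s - 1) :
    (p ^ s ≡ 1 [MOD 4] →
      RatModEq p (s + 4) (ramanujanPartialSum m)
        (shiftedFactorial (1 / 2) ((p ^ s - 1) / 4) ^ 2 /
            shiftedFactorial 1 ((p ^ s - 1) / 4) ^ 2 *
          ((p : ℚ) ^ s + (p : ℚ) ^ (3 * s) / 4 * harmonicOrder 2 ((p ^ s - 1) / 2)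
            - (p : ℚ) ^ (3 * s) / 8 * harmonicOrder 2 ((p ^ s - 1) / 4)))) ∧
    (p ^ s ≡ 3 [MOD 4] →
      RatModEq p (s + 4) (ramanujanPartialSum m)
        ((p : ℚ) ^ (2 * s) *
          (shiftedFactorial (3 / 4) ((p ^ s - 1) / 2) /
            shiftedFactorial (5 / 4) ((p ^ s - 1) / 2)))) := by
  have : Fact p.Prime := ⟨hp⟩
  obtain ⟨t, rfl⟩ := Nat.exists_eq_add_of_le' hs
  obtain ⟨g, hg⟩ := ramanujanPartialSum_sub_half hp2 hm
  obtain ⟨h, hh⟩ := deviation_divisible hp2 t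
  have hn := two_mul_half_add_one (p := p) hp2 (t + 1)
  have hM := ramanujanPartialSum_eq_whippleSum ((p ^ (t + 1) - 1) / 2)
  rw [hh] at hM
  have hnQ : (2 * ((p ^ (t + 1) - 1) / 2 : ℕ) + 1 : ℚ) = (p : ℚ) ^ (t + 1) := by
    exact_mod_cast hn
  rw [hnQ] at hM
  constructor
  · intro hmod
    rw [Nat.ModEq] at hmod
    obtain ⟨N, hN⟩ : ∃ N, p ^ (t + 1) = 4 * N + 1 := ⟨p ^ (t + 1) / 4, by omega⟩
    obtain ⟨C, hC0, hC⟩ := exists_qHalfRatio (p := p) hp2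
    obtain ⟨f, hf⟩ := whippleSum_even_half hN
    rw [show (p ^ (t + 1) - 1) / 2 = 2 * N by omega] at *
    rw [show (p ^ (t + 1) - 1) / 4 = N by omega, ← div_pow, shiftedFactorial_half_div]
    rw [whippleSum_even_zero, hf, pow_mul (-1 : ℚ), neg_one_sq, one_pow, one_mul] at hM
    -- The three witnesses are the tail, the quadratic error, and the p⁴ remainder of Whipple's
    -- product, the last multiplied by the prefactor n. For odd M the product is exact and only two
    -- remain.
    refine ratModEq_of_atOne (f := g + h - C N ^ 2 * f) ?_
    simp only [map_sub, map_add, map_mul, map_pow, atOne_qHalfRatio hC0 hC]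
    rw [pow_add _ (t + 1) 4, show 3 * (t + 1) = (t + 1) * 3 by ring, pow_mul] at *
    linear_combination hg + hM
  · intro hmod
    rw [Nat.ModEq] at hmod
    obtain ⟨N, hN⟩ : ∃ N, p ^ (t + 1) = 4 * N + 3 := ⟨p ^ (t + 1) / 4, by omega⟩
    have hN' : (4 * N + 3 : ℚ) = (p : ℚ) ^ (t + 1) := by exact_mod_cast hN.symm
    rw [show (p ^ (t + 1) - 1) / 2 = 2 * N + 1 by omega] at *
    rw [whippleSum_odd_zero, whippleSum_odd_half, pow_succ (-1 : ℚ), pow_mul (-1 : ℚ), neg_one_sq,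
      one_pow, one_mul, hN'] at hM
    refine ratModEq_of_atOne (f := g + h) ?_
    rw [map_add]
    linear_combination hg + hM
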